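/- Let $T_k=2^k$. Fix $\eta\in(0,1/2)$, $\lambda,\mu\ge 16/\eta$ and $q>1$. Let $(X^j_{k,l,m})$, $j\in\{1,2\}$, $k\ge 1$, $(l,m)\in\mathbb Z^2$, be independent random variables on a probability space $(\Omega,\mathcal F,\mathbb P)$, where $X^j_{k,l,m}$ is Bernoulli of parameter $T_k^{-2}$. **The environment.** For each $(k,l,m)$ with $X^1_{k,l,m}=1$ consider the horizontal rectangle of level $k$ centred at $(l,m)$, $\{|x_1-l|\le\frac{\lambda T_k+1}2,\ |x_2-m|\le\frac{\mu+1}2\}$, and for each $(k,l,m)$ with $X^2_{k,l,m}=1$ the vertical rectangle of level $k$ centred at $(l,m)$, $\{|x_1-l|\le\frac{\mu+1}2,\ |x_2-m|\le\frac{\lambda T_k+1}2\}$. Let $c^1_\omega(x)=-\frac12$ if $x$ lies in a horizontal rectangle, and $c^1_\omega(x)=0$ otherwise. Let $c^2_\omega$ be the outcome of the following procedure: start from $c^1_\omega$; at step $k=1,2,\dots$, for each $x$ in a vertical rectangle of level $k$, leave the value at $x$ unchanged if $x$ lies in a horizontal rectangle of a level $k'>k$; otherwise set it to $0$ if $x$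 lies in a horizontal rectangle of level $k$, and to $\frac12$ if not. (At each $x$ the value is eventually constant in $k$.) Finally let $$c_\omega(x)=\begin{cases}\max\big(\inf_{y\in\mathbb R^2}\{c^2_\omega(y)+|x-y|\},0\big)&\text{if }c^2_\omega(x)\ge 0,\\ \min\big(\sup_{y\in\mathbb R^2}\{c^2_\omega(y)-|x-y|\},0\big)&\text{if }c^2_\omega(x)<0,\end{cases}$$ where $|\cdot|$ is the Euclidean norm. **The equation.** For $h:\mathbb R^2\to\mathbb R$ and $c:\mathbb R^2\to\mathbb R$, a solution for $\varepsilon>0$ of $$\partial_t u^\varepsilon+h(\nabla u^\varepsilon)-c(x/\varepsilon)-\varepsilon\Delta u^\varepsilon=0\ \text{ in }(0,\infty)\times\mathbb R^2,\qquad u^\varepsilon(0,\cdot)=0,\tag{E}$$ means a viscosity solution that is continuous on $[0,\infty)\times\mathbb R^2$ and bounded on $[0,T]\times\mathbb R^2$ for every $T$. **Theorem.** 1. $c_\omega$ is, for every $\omega$, $1$-Lipschitz with values in $[-\frac12,\frac12]$; the random field $c$ is stationary and ergodic for the translations by $\mathbb Z^2$. The function $h_q(p)=|p_2|-|p_1|+\max(\|p\|_\infty-2,0)^q$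 is locally Lipschitz, coercive, of superlinear growth, and not convex. Almost surely, if for every $\varepsilon>0$ the function $u^\varepsilon$ is a solution of (E) with $h=h_q$, $c=c_\omega$ (that is, with Hamiltonian $H(p,x,\omega)=-c_\omega(x)+|p_2|-|p_1|+\max(\|p\|_\infty-2,0)^q$), then $$\liminf_{\varepsilon\to0^+}u^\varepsilon(1,0)\le-\tfrac12+\eta,\qquad\limsup_{\varepsilon\to0^+}u^\varepsilon(1,0)\ge\tfrac12-\eta,$$ and $u^\varepsilon(1,0)$ does not converge as $\varepsilon\to0^+$: there is no stochastic homogenization. 2. There exist a globally Lipschitz, coercive, non-convex function $h:\mathbb R^2\to\mathbb R$ and a random field $c$ on $\mathbb R^2$, uniformly bounded, uniformly Lipschitz, and stationary and ergodic for all translations of $\mathbb R^2$, such that homogenization fails for (E): almost surely, if for every $\varepsilon>0$ the function $u^\varepsilon$ is a solution of (E) with this $h$ and $c=c_\omega$, then $u^\varepsilon(1,0)$ does not converge as $\varepsilon\to0^+$. -/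

import Mathlib

open MeasureTheory ProbabilityTheory Filter Topology

namespace ViscousHJ

/-- The Euclidean plane; `x 0` and `x 1` are the first and second coordinates. -/
abbrev Plane : Type := EuclideanSpace ℝ (Fin 2)

/-! ### The environment -/

/-- The index set of the Bernoulli variables: orientation (`0` horizontal, `1` vertical), level
`k ≥ 1`, and the integer coordinates `(l, m)` of the centre. -/
abbrev Site : Type := Fin 2 × ℕ+ × ℤ × ℤ

/-- `X` is an independent family of random variables with values in `{0, 1}` (`false`, `true`), and
`X (j, k, l, m)` is Bernoulli of parameter `T_k ^ (-2)`, where `T_k = 2 ^ k`. -/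
structure IsBernoulliFamily {Ω : Type*} [MeasurableSpace Ω] (P : Measure Ω)
    (X : Site → Ω → Bool) : Prop where
  measurable : ∀ i, Measurable (X i)
  indep : iIndepFun X P
  law : ∀ (j : Fin 2) (k : ℕ+) (l m : ℤ),
    P {ω | X (j, k, l, m) ω = true} = ENNReal.ofReal (((2 : ℝ) ^ (k : ℕ))⁻¹ ^ 2)

/-- `x` lies in a selected horizontal rectangle of length `lam * 2 ^ k + 1` and width `mu + 1`. -/
def InHorizontal (lam mu : ℝ) (ξ : Site → Bool) (k : ℕ+) (x : Plane) : Prop :=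
  ∃ l m : ℤ, ξ (0, k, l, m) = true ∧
    |x 0 - l| ≤ (lam * 2 ^ (k : ℕ) + 1) / 2 ∧ |x 1 - m| ≤ (mu + 1) / 2

/-- `x` lies in a selected vertical rectangle of length `lam * 2 ^ k + 1` and width `mu + 1`. -/
def InVertical (lam mu : ℝ) (ξ : Site → Bool) (k : ℕ+) (x : Plane) : Prop :=
  ∃ l m : ℤ, ξ (1, k, l, m) = true ∧
    |x 0 - l| ≤ (mu + 1) / 2 ∧ |x 1 - m| ≤ (lam * 2 ^ (k : ℕ) + 1) / 2

open Classical in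
/-- The weights after phase 1: `-1/2` on the horizontal rectangles, `0` elsewhere. -/
noncomputable def weight1 (lam mu : ℝ) (ξ : Site → Bool) (x : Plane) : ℝ :=
  if ∃ k, InHorizontal lam mu ξ k x then -(1 / 2) else 0

open Classical in
/-- The weights after the steps `1, …, n` of phase 2. At step `k`, a point of a vertical rectangle
of level `k` keeps its weight if it lies in a horizontal rectangle of a level `k' > k`, gets the
weight `0` if it lies in one of level `k' = k` but in none of a larger level, and gets the weight
`1/2` otherwise. -/
noncomputable def weight2Step (lam mu : ℝ) (ξ : Site → Bool) (x : Plane) : ℕ → ℝ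
  | 0 => weight1 lam mu ξ x
  | n + 1 =>
    if InVertical lam mu ξ n.succPNat x then
      if ∃ k', n.succPNat < k' ∧ InHorizontal lam mu ξ k' x then weight2Step lam mu ξ x n
      else if InHorizontal lam mu ξ n.succPNat x then 0
      else 1 / 2
    else weight2Step lam mu ξ x n

open Classical in
/-- The weights at the end of phase 2, in closed form; `weight2Step_eventually_eq` shows that they
are the final values of the step-by-step procedure. -/
noncomputable def weight2 (lam mu : ℝ) (ξ : Site → Bool) (x : Plane) : ℝ :=
  if ∃ k, InVertical lam mu ξ k x ∧ ∀ k', k ≤ k' → ¬ InHorizontal lam mu ξ k' x then 1 / 2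
  else if ∃ k, InVertical lam mu ξ k x ∧ InHorizontal lam mu ξ k x ∧
      ∀ k', k < k' → ¬ InHorizontal lam mu ξ k' x then 0
  else weight1 lam mu ξ x

theorem weight2Step_eventually_eq (lam mu : ℝ) (ξ : Site → Bool) (x : Plane) :
    ∀ᶠ n in atTop, weight2Step lam mu ξ x n = weight2 lam mu ξ x := by
  classical
  have key : ∀ (v : ℝ) (k : ℕ+), weight2Step lam mu ξ x k = v →
      (∀ n : ℕ, (k : ℕ) ≤ n → weight2Step lam mu ξ x n = v → weight2Step lam mu ξ x (n + 1) = v) →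
      ∀ᶠ n in atTop, weight2Step lam mu ξ x n = v := by
    intro v k h0 h1
    filter_upwards [eventually_ge_atTop (k : ℕ)] with n hn
    induction n, hn using Nat.le_induction with
    | base => exact h0
    | succ n hn ih => exact h1 n hn ih
  have lt_succ : ∀ (k : ℕ+) (n : ℕ), (k : ℕ) ≤ n → k < n.succPNat := by
    intro k n h
    rw [← PNat.coe_lt_coe, Nat.succPNat_coe]
    omega
  unfold weight2
  split_ifs with hA hB
  · obtain ⟨k, hV, hH⟩ := hA
    refine key _ k ?_ ?_
    · obtain ⟨n, rfl⟩ : ∃ n : ℕ, k = n.succPNat := ⟨k.natPred, by simp⟩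
      rw [Nat.succPNat_coe, weight2Step, if_pos hV, if_neg, if_neg (hH _ le_rfl)]
      rintro ⟨k', hk', h⟩
      exact hH k' hk'.le h
    · intro n hn ih
      have hk := lt_succ k n hn
      rw [weight2Step]
      split_ifs with h1 h2 h3
      · exact ih
      · exact absurd h3 (hH _ hk.le)
      · rfl
      · exact ih
  · obtain ⟨k, hV, hH, hlt⟩ := hB
    refine key _ k ?_ ?_
    · obtain ⟨n, rfl⟩ : ∃ n : ℕ, k = n.succPNat := ⟨k.natPred, by simp⟩
      rw [Nat.succPNat_coe, weight2Step, if_pos hV, if_neg, if_pos hH]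
      rintro ⟨k', hk', h⟩
      exact hlt k' hk' h
    · intro n hn ih
      have hk := lt_succ k n hn
      rw [weight2Step]
      split_ifs with h1 h2 h3
      · exact ih
      · rfl
      · exact absurd ⟨n.succPNat, h1, fun k' hk' => hlt k' (hk.trans_le hk')⟩ hA
      · exact ih
  · refine Eventually.of_forall fun n => ?_
    induction n with
    | zero => rfl
    | succ n ih =>
      rw [weight2Step]
      split_ifs with h1 h2 h3
      · exact ih
      · exact absurd ⟨n.succPNat, h1, h3, fun k' hk' h => h2 ⟨k', hk', h⟩⟩ hB
      · refine absurd ⟨n.succPNat, h1, fun k' hk' h => ?_⟩ hA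
        rcases hk'.eq_or_lt with rfl | hlt
        · exact h3 h
        · exact h2 ⟨k', hlt, h⟩
      · exact ih

/-- The weight function after phase 3, which turns `weight2` into a Lipschitz function. -/
noncomputable def weight (lam mu : ℝ) (ξ : Site → Bool) (x : Plane) : ℝ :=
  if 0 ≤ weight2 lam mu ξ x then max (⨅ y : Plane, (weight2 lam mu ξ y + dist x y)) 0
  else min (⨆ y : Plane, (weight2 lam mu ξ y - dist x y)) 0

/-- The random field `c_ω` built from the Bernoulli family `X`. -/
noncomputable def environment {Ω : Type*} (lam mu : ℝ) (X : Site → Ω → Bool) (ω : Ω)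
    (x : Plane) : ℝ :=
  weight lam mu (fun i => X i ω) x

/-! ### Stationary ergodic random fields -/

/-- The points of the plane with integer coordinates. -/
def integerLattice : Set Plane := {z | ∀ i, ∃ n : ℤ, z i = n}

/-- The random field `c` is stationary and ergodic for the translations by the vectors of `G`. The
space `Plane → ℝ` of fields carries the product σ-algebra. In the last clause `A` is only almost
surely invariant under each translation: strict invariance under all translations of the plane
would force a set of the product σ-algebra to be trivial. -/
structure IsStationaryErgodic {Ω : Type*} [MeasurableSpace Ω] (P : Measure Ω)
    (c : Ω → Plane → ℝ) (G : Set Plane) : Prop where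
  aemeasurable : AEMeasurable c P
  stationary : ∀ z ∈ G, IdentDistrib (fun ω x => c ω (x + z)) c P P
  ergodic : ∀ A : Set (Plane → ℝ), MeasurableSet A →
    (∀ z ∈ G, ∀ᵐ ω ∂P, ((fun x => c ω (x + z)) ∈ A ↔ c ω ∈ A)) →
    (∀ᵐ ω ∂P, c ω ∈ A) ∨ (∀ᵐ ω ∂P, c ω ∉ A)

/-! ### The Hamilton-Jacobi equation -/

/-- `h(p) = |p₂| - |p₁| + max (‖p‖_∞ - 2, 0) ^ q`. -/
noncomputable def saddle (q : ℝ) (p : Plane) : ℝ :=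
  |p 1| - |p 0| + max (max |p 0| |p 1| - 2) 0 ^ q

/-- The value at `(t, x)` of `∂_t φ + H(∇φ, x / ε) - ε Δφ`, for a smooth function `φ`. -/
noncomputable def hjOperator (H : Plane → Plane → ℝ) (ε : ℝ) (φ : ℝ × Plane → ℝ) (t : ℝ)
    (x : Plane) : ℝ :=
  deriv (fun s => φ (s, x)) t + H (gradient (fun y => φ (t, y)) x) (ε⁻¹ • x)
    - ε * Laplacian.laplacian (fun y => φ (t, y)) x

/-- `u` is a continuous viscosity solution, bounded on `[0, T] × ℝ²` for every `T`, of
`∂_t u + H(∇u, x / ε) - ε Δu = 0` in `(0, ∞) × ℝ²`, `u(0, ·) = 0`. (The values of `u` at negative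
times are irrelevant.) -/
structure IsSolution (H : Plane → Plane → ℝ) (ε : ℝ) (u : ℝ → Plane → ℝ) : Prop where
  continuousOn : ContinuousOn (fun z : ℝ × Plane => u z.1 z.2) (Set.Ici 0 ×ˢ Set.univ)
  bounded : ∀ T : ℝ, ∃ C : ℝ, ∀ t ∈ Set.Icc 0 T, ∀ x, |u t x| ≤ C
  initial : ∀ x, u 0 x = 0
  subsolution : ∀ φ : ℝ × Plane → ℝ, ContDiff ℝ 2 φ → ∀ (t : ℝ) (x : Plane), 0 < t →
    IsLocalMax (fun z : ℝ × Plane => u z.1 z.2 - φ z) (t, x) → hjOperator H ε φ t x ≤ 0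
  supersolution : ∀ φ : ℝ × Plane → ℝ, ContDiff ℝ 2 φ → ∀ (t : ℝ) (x : Plane), 0 < t →
    IsLocalMin (fun z : ℝ × Plane => u z.1 z.2 - φ z) (t, x) → 0 ≤ hjOperator H ε φ t x

/-- `u ε`, for `ε > 0`, is a solution of the equation with Hamiltonian `H(p, y) = h(p) - c(y)`. -/
def IsSolutionFamily (h c : Plane → ℝ) (u : ℝ → ℝ → Plane → ℝ) : Prop :=
  ∀ ε : ℝ, 0 < ε → IsSolution (fun p y => h p - c y) ε (u ε)

end ViscousHJ

namespace ViscousHJ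

/-! For slopes at most 2 the Hamiltonian is `|p₂| - |p₁| - c`, that of a noisy game in which one
player moves `x₂` and minimises the accumulated `c` while the other moves `x₁` and maximises it,
both at speed at most 1. Take `ε = 2 ^ (-k)`. A horizontal rectangle of level `k` becomes a strip of
length about `lam` and width about `mu * ε`. If it passes close to the origin and no vertical
rectangle of level at least `k` cuts it, the minimiser steers onto it and stays there: the opponent
cannot reach its ends in unit time, and the noise, of size `ε`, is weak against the width. Hence `u
ε 1 0` is nearly `-1/2`. A vertical rectangle gives nearly `1/2` in the same way. Both situations
occur at infinitely many scales almost surely, so there is no limit.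

Analytically, strategies are replaced by one explicit barrier, affine in time plus smoothed
distances to the centre of the strip (`SeparableSubsolution.le_of_strip`), and by a comparison
principle restricted to separable barriers (`SeparableSubsolution.le_of_supersolution`). Barriers
have slope at most 2, so the coercive correction in the Hamiltonian is never seen. The upper bound
applied to `-u`, with the coordinates exchanged and `c` replaced by `-c`, is the lower bound.

Probabilistically, the exponent in `T_k ^ (-2)` is critical. A box of side of order `T_k` carries a
number of level-`k` centres whose mean is bounded below uniformly in `k`. The vertical rectangles of
level `k' ≥ k` that could cut the strip have mean number of order `2 ^ (k - k')`, with a bounded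
sum. So a good strip exists at each scale with probability bounded below (`le_familyLaw_hasStrip`),
and a zero-one law upgrades this to infinitely many scales (`ae_frequently_hasStrip`).

Ergodicity under the lattice comes from approximation by cylinders and independence of distant
sites. For stationarity under all translations the field is shifted by an independent uniform point
of the torus, which turns translations into a skew product over rotations. -/

/-! ### Separable test functions -/

theorem contDiff_coord {n : WithTop ℕ∞} {g : ℝ → ℝ} (hg : ContDiff ℝ n g) (i : Fin 2) :
    ContDiff ℝ n fun y : Plane => g (y i) :=
  hg.comp (EuclideanSpace.proj (𝕜 := ℝ) i).contDiff

theorem hasGradientAt_coord {g : ℝ → ℝ} (i : Fin 2) (x : Plane)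
    (hg : DifferentiableAt ℝ g (x i)) :
    HasGradientAt (fun y : Plane => g (y i)) (deriv g (x i) • EuclideanSpace.single i 1) x := by
  rw [hasGradientAt_iff_hasFDerivAt]
  have h := hg.hasDerivAt.comp_hasFDerivAt x (EuclideanSpace.proj (𝕜 := ℝ) i).hasFDerivAt
  refine h.congr_fderiv ?_
  ext y
  simp [EuclideanSpace.inner_single_left]

theorem laplacian_coord {g : ℝ → ℝ} (hg : ContDiff ℝ 2 g) (i : Fin 2) (x : Plane) :
    Laplacian.laplacian (fun y : Plane => g (y i)) x = deriv (deriv g) (x i) := by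
  rw [InnerProductSpace.laplacian_eq_iteratedFDeriv_orthonormalBasis _
    (EuclideanSpace.basisFun (Fin 2) ℝ)]
  have h : (fun y : Plane => g (y i)) = g ∘ (EuclideanSpace.proj (𝕜 := ℝ) i) := rfl
  have key : ∀ v : Plane, iteratedFDeriv ℝ 2 (fun y : Plane => g (y i)) x ![v, v]
      = v i * (v i * deriv (deriv g) (x i)) := by
    intro v
    rw [h, (EuclideanSpace.proj (𝕜 := ℝ) i).iteratedFDeriv_comp_right hg x le_rfl,
      ContinuousMultilinearMap.compContinuousLinearMap_apply,
      iteratedFDeriv_apply_eq_iteratedDeriv_mul_prod, iteratedDeriv_succ, iteratedDeriv_one]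
    simp [Fin.prod_univ_two, mul_assoc]
  simp only [key, Fin.sum_univ_two]
  fin_cases i <;> simp

theorem hjOperator_separable (H : Plane → Plane → ℝ) (ε : ℝ) {τ g f : ℝ → ℝ}
    (hg : ContDiff ℝ 2 g) (hf : ContDiff ℝ 2 f) (t : ℝ) (x : Plane) :
    hjOperator H ε (fun z => τ z.1 + (g (z.2 0) + f (z.2 1))) t x =
      deriv τ t + H !₂[deriv g (x 0), deriv f (x 1)] (ε⁻¹ • x)
        - ε * (deriv (deriv g) (x 0) + deriv (deriv f) (x 1)) := by
  have e1 : deriv (fun s => τ s + (g (x 0) + f (x 1))) t = deriv τ t := by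
    rw [deriv_add_const]
  have e2 : gradient (fun y : Plane => τ t + (g (y 0) + f (y 1))) x =
      !₂[deriv g (x 0), deriv f (x 1)] := by
    have h0 := hasGradientAt_coord 0 x (hg.differentiable (by norm_num) (x 0))
    have h1 := hasGradientAt_coord 1 x (hf.differentiable (by norm_num) (x 1))
    rw [hasGradientAt_iff_hasFDerivAt] at h0 h1
    have h2 := (h0.add h1).const_add (τ t)
    rw [← map_add] at h2
    have h3 : HasGradientAt (fun y : Plane => τ t + (g (y 0) + f (y 1)))
      (deriv g (x 0) • EuclideanSpace.single 0 1 + deriv f (x 1) • EuclideanSpace.single 1 1) x :=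
      hasGradientAt_iff_hasFDerivAt.2 h2
    rw [h3.gradient]
    ext i
    fin_cases i <;> simp
  have e3 : Laplacian.laplacian (fun y : Plane => τ t + (g (y 0) + f (y 1))) x =
      deriv (deriv g) (x 0) + deriv (deriv f) (x 1) := by
    have hc : ContDiffAt ℝ 2 (fun _ : Plane => τ t) x := contDiffAt_const
    have h0 := (contDiff_coord hg 0).contDiffAt (x := x)
    have h1 := (contDiff_coord hf 1).contDiffAt (x := x)
    have := hc.laplacian_add (h0.add h1)
    have h2 := h0.laplacian_add h1
    rw [laplacian_coord hg, laplacian_coord hf] at h2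
    refine this.trans ?_
    rw [InnerProductSpace.laplacian_const, Pi.zero_apply]
    exact (zero_add _).trans h2
  simp only [hjOperator, e1, e2, e3]

/-- The subsolution property, tested with separable functions of slope at most `2`, for the
equation `∂_t v + |∂_j v| - |∂_i v| - c - ε Δ v = 0`. -/
def SeparableSubsolution (i j : Fin 2) (c : Plane → ℝ) (ε : ℝ) (v : ℝ → Plane → ℝ) : Prop :=
  ∀ τ g f : ℝ → ℝ, ContDiff ℝ 2 τ → ContDiff ℝ 2 g → ContDiff ℝ 2 f → ∀ (t : ℝ) (x : Plane),
    0 < t → IsLocalMax (fun z : ℝ × Plane => v z.1 z.2 - (τ z.1 + (g (z.2 i) + f (z.2 j)))) (t, x) →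
    |deriv g (x i)| ≤ 2 → |deriv f (x j)| ≤ 2 →
    deriv τ t + |deriv f (x j)| - |deriv g (x i)| - c (ε⁻¹ • x)
      - ε * (deriv (deriv g) (x i) + deriv (deriv f) (x j)) ≤ 0

theorem contDiff_separable {τ g f : ℝ → ℝ} (hτ : ContDiff ℝ 2 τ) (hg : ContDiff ℝ 2 g)
    (hf : ContDiff ℝ 2 f) :
    ContDiff ℝ 2 fun z : ℝ × Plane => τ z.1 + (g (z.2 0) + f (z.2 1)) :=
  (hτ.comp contDiff_fst).add
    (((contDiff_coord hg 0).comp contDiff_snd).add ((contDiff_coord hf 1).comp contDiff_snd))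

section solution

variable {h c : Plane → ℝ} {ε : ℝ} {u : ℝ → Plane → ℝ}

/-- Only test functions with slopes at most 2 are used, and there `h` is the pure saddle. One
argument thus serves both the superlinear and the globally Lipschitz Hamiltonian. -/
theorem IsSolution.separableSubsolution (hh : ∀ p : Plane, |p 0| ≤ 2 → |p 1| ≤ 2 →
    h p = |p 1| - |p 0|) (hu : IsSolution (fun p y => h p - c y) ε u) :
    SeparableSubsolution 0 1 c ε u := by
  intro τ g f hτ hg hf t x ht hmax h0 h1
  have := hu.subsolution _ (contDiff_separable hτ hg hf) t x ht hmax
  rw [hjOperator_separable _ _ hg hf, hh _ (by simpa using h0) (by simpa using h1)] at this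
  simp only [Matrix.cons_val_zero, Matrix.cons_val_one] at this
  linarith

/-- Changing the sign of `u` turns the supersolution property into a subsolution property and
exchanges the roles of the two players, hence the indices `1 0` and the field `-c`. -/
theorem IsSolution.separableSubsolution_neg (hh : ∀ p : Plane, |p 0| ≤ 2 → |p 1| ≤ 2 →
    h p = |p 1| - |p 0|) (hu : IsSolution (fun p y => h p - c y) ε u) :
    SeparableSubsolution 1 0 (fun y => - c y) ε (fun t x => - u t x) := by
  intro τ g f hτ hg hf t x ht hmax h0 h1
  have hmin : IsLocalMin (fun z : ℝ × Plane => u z.1 z.2 -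
      ((-τ) z.1 + ((-f) (z.2 0) + (-g) (z.2 1)))) (t, x) := by
    have := hmax.neg
    refine this.congr (Eventually.of_forall fun z => ?_)
    simp only [Pi.neg_apply]
    ring
  have := hu.supersolution _ (contDiff_separable hτ.neg hf.neg hg.neg) t x ht hmin
  have hd : ∀ k : ℝ → ℝ, deriv (-k) = - deriv k := fun k => by ext s; simp [deriv.neg]
  have hf' : ContDiff ℝ 2 (-f) := hf.neg
  have hg' : ContDiff ℝ 2 (-g) := hg.neg
  change 0 ≤ hjOperator (fun p y => h p - c y) ε
    (fun z => (-τ) z.1 + ((-f) (z.2 0) + (-g) (z.2 1))) t x at this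
  rw [hjOperator_separable _ _ hf' hg',
    hh _ (by simpa [hd] using h1) (by simpa [hd] using h0)] at this
  simp only [Matrix.cons_val_zero, Matrix.cons_val_one, hd, Pi.neg_apply,
    abs_neg] at this
  linarith

end solution

/-! ### Comparison with separable barriers -/

/-- Both summands are bounded below, so the sum is large as soon as one coordinate leaves a compact
set. This coercivity makes maxima exist on the unbounded plane. -/
theorem tendsto_coord_add_atTop {i j : Fin 2} (hij : i ≠ j) {g f : ℝ → ℝ} (hg : Continuous g)
    (hf : Continuous f) (hg' : Tendsto g (cocompact ℝ) atTop)
    (hf' : Tendsto f (cocompact ℝ) atTop) :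
    Tendsto (fun x : Plane => g (x i) + f (x j)) (cocompact Plane) atTop := by
  obtain ⟨a, ha⟩ := hg.exists_forall_le hg'
  obtain ⟨b, hb⟩ := hf.exists_forall_le hf'
  refine tendsto_atTop.2 fun A => ?_
  obtain ⟨Kg, hKg, hg1⟩ := mem_cocompact.1 (hg'.eventually_ge_atTop (A - f b))
  obtain ⟨Kf, hKf, hf1⟩ := mem_cocompact.1 (hf'.eventually_ge_atTop (A - g a))
  have hcl : IsCompact ((EuclideanSpace.equiv (Fin 2) ℝ).toHomeomorph ⁻¹'
      (Set.univ.pi fun k => if k = i then Kg else Kf)) := by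
    rw [Homeomorph.isCompact_preimage]
    refine isCompact_univ_pi fun k => ?_
    split_ifs <;> assumption
  refine mem_cocompact.2 ⟨_, hcl, fun x hx => ?_⟩
  by_contra hlt
  have hlt' : g (x i) + f (x j) < A := not_le.1 hlt
  refine hx fun k _ => ?_
  change x k ∈ if k = i then Kg else Kf
  split_ifs with hk
  · subst hk
    by_contra hn
    have h1 : A - f b ≤ g (x k) := hg1 hn
    linarith [hb (x j)]
  · have hk' : k = j := by omega
    subst hk'
    by_contra hn
    have h1 : A - g a ≤ f (x k) := hf1 hn
    linarith [ha (x i)]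

/-- A subsolution lies below every separable coercive supersolution. -/
theorem SeparableSubsolution.le_of_supersolution {i j : Fin 2} (hij : i ≠ j) {c : Plane → ℝ}
    {ε : ℝ} {v : ℝ → Plane → ℝ} (hv : SeparableSubsolution i j c ε v)
    (hcont : ContinuousOn (fun z : ℝ × Plane => v z.1 z.2) (Set.Ici 0 ×ˢ Set.univ))
    (hbdd : ∀ T : ℝ, ∃ C : ℝ, ∀ t ∈ Set.Icc 0 T, ∀ x, |v t x| ≤ C) (hzero : ∀ x, v 0 x = 0)
    {τ g f : ℝ → ℝ} (hτ : ContDiff ℝ 2 τ) (hg : ContDiff ℝ 2 g) (hf : ContDiff ℝ 2 f)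
    (hg2 : ∀ s, |deriv g s| ≤ 2) (hf2 : ∀ s, |deriv f s| ≤ 2)
    (hgc : Tendsto g (cocompact ℝ) atTop) (hfc : Tendsto f (cocompact ℝ) atTop)
    (hinit : ∀ x : Plane, 0 ≤ τ 0 + (g (x i) + f (x j))) {T T' : ℝ} (hTT' : T < T')
    (hsup : ∀ t ∈ Set.Ioo 0 T', ∀ x : Plane, τ t + (g (x i) + f (x j)) < v t x →
      0 ≤ deriv τ t + |deriv f (x j)| - |deriv g (x i)| - c (ε⁻¹ • x)
        - ε * (deriv (deriv g) (x i) + deriv (deriv f) (x j)))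
    {t : ℝ} (ht : t ∈ Set.Icc 0 T) (x : Plane) : v t x ≤ τ t + (g (x i) + f (x j)) := by
  refine le_of_forall_pos_le_add fun γ hγ => ?_
  by_contra! hlt
  have hco := tendsto_coord_add_atTop hij hg.continuous hf.continuous hgc hfc
  have hgf : Continuous fun x : Plane => g (x i) + f (x j) :=
    ((contDiff_coord hg i).add (contDiff_coord hf j)).continuous
  obtain ⟨y₀, hy₀⟩ := hgf.exists_forall_le hco
  obtain ⟨C, hC⟩ := hbdd T'
  obtain ⟨B, hB⟩ := (isCompact_Icc (a := (0 : ℝ)) (b := T')).exists_bound_of_continuousOn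
    hτ.continuous.continuousOn
  set M := C + B - (g (y₀ i) + f (y₀ j)) with hM
  have hwM : ∀ s ∈ Set.Icc 0 T', ∀ y, v s y - (τ s + (g (y i) + f (y j))) ≤ M := fun s hs y => by
    have h1 := (abs_le.1 (hC s hs y)).2
    have h2 := (abs_le.1 (hB s hs)).1
    have h3 := hy₀ y
    simp only at h3
    linarith
  -- The penalty `γ * exp (N * (s - T))` is at most `γ` up to time `T`, exceeds the bound `M` at
  -- time `T'`, and is strictly increasing. It keeps the maximum away from the final time `T'` and
  -- makes the barrier strict.
  obtain ⟨N, hN0, hN⟩ : ∃ N : ℝ, 0 < N ∧ M < γ * Real.exp (N * (T' - T)) := by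
    have h1 : Tendsto (fun N : ℝ => γ * Real.exp (N * (T' - T))) atTop atTop :=
      (Real.tendsto_exp_atTop.comp (tendsto_id.atTop_mul_const (sub_pos.2 hTT'))).const_mul_atTop hγ
    exact ((eventually_gt_atTop 0).and (h1.eventually_gt_atTop M)).exists
  set E : ℝ → ℝ := fun s => γ * Real.exp (N * (s - T)) with hE
  have hEd : ∀ s, HasDerivAt E (γ * (Real.exp (N * (s - T)) * N)) s := fun s => by
    have h1 : HasDerivAt (fun s => N * (s - T)) N s := by
      simpa using ((hasDerivAt_id s).sub_const T).const_mul N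
    exact h1.exp.const_mul γ
  have hEc : ContDiff ℝ 2 E :=
    contDiff_const.mul (Real.contDiff_exp.comp (contDiff_const.mul (contDiff_id.sub contDiff_const)))
  have hEpos : ∀ s, 0 < E s := fun s => by positivity
  have htT' : t ∈ Set.Icc 0 T' := ⟨ht.1, ht.2.trans hTT'.le⟩
  set K : Set (ℝ × Plane) := Set.Icc 0 T' ×ˢ Set.univ with hK
  set F : ℝ × Plane → ℝ := fun z => v z.1 z.2 - ((τ + E) z.1 + (g (z.2 i) + f (z.2 j))) with hF
  have hFcont : ContinuousOn F K := by
    refine (hcont.mono (Set.prod_mono Set.Icc_subset_Ici_self subset_rfl)).sub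
      (Continuous.continuousOn ?_)
    exact ((hτ.add hEc).continuous.comp continuous_fst).add (hgf.comp continuous_snd)
  have hFt : 0 < F (t, x) := by
    have h1 : E t ≤ γ := by
      have : Real.exp (N * (t - T)) ≤ 1 :=
        Real.exp_le_one_iff.2 (mul_nonpos_of_nonneg_of_nonpos hN0.le (sub_nonpos.2 ht.2))
      simpa [hE] using mul_le_mul_of_nonneg_left this hγ.le
    simp only [hF, Pi.add_apply]
    linarith
  have hev : ∀ᶠ z in cocompact (ℝ × Plane) ⊓ 𝓟 K, F z ≤ F (t, x) := by
    rw [eventually_inf_principal]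
    obtain ⟨S, hS, hS'⟩ := mem_cocompact.1 (hco.eventually_ge_atTop (C + B))
    refine mem_cocompact.2 ⟨Set.Icc 0 T' ×ˢ S, isCompact_Icc.prod hS, ?_⟩
    rintro ⟨s, y⟩ hsy hsK
    have hs : s ∈ Set.Icc 0 T' := hsK.1
    have hy : y ∉ S := fun hy => hsy ⟨hs, hy⟩
    have h0 : C + B ≤ g (y i) + f (y j) := hS' hy
    have h1 := (abs_le.1 (hC s hs y)).2
    have h2 := (abs_le.1 (hB s hs)).1
    have h3 := hEpos s
    simp only [hF, Pi.add_apply] at hFt ⊢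
    linarith
  obtain ⟨⟨t₀, x₀⟩, hz, hmax⟩ := hFcont.exists_isMaxOn' (isClosed_Icc.prod isClosed_univ)
    (show (t, x) ∈ K from ⟨htT', trivial⟩) hev
  have hpos : 0 < F (t₀, x₀) := hFt.trans_le (hmax (show (t, x) ∈ K from ⟨htT', trivial⟩))
  have ht₀ : t₀ ∈ Set.Icc 0 T' := hz.1
  have hE₀ := hEpos t₀
  have hpos' : 0 < v t₀ x₀ - (τ t₀ + E t₀ + (g (x₀ i) + f (x₀ j))) := hpos
  have h0 : t₀ ≠ 0 := by
    rintro rfl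
    linarith [hinit x₀, hzero x₀]
  have h1 : t₀ ≠ T' := by
    rintro rfl
    have := hwM t₀ ht₀ x₀
    have : M < E t₀ := hN
    linarith
  have hIoo : t₀ ∈ Set.Ioo 0 T' := ⟨lt_of_le_of_ne ht₀.1 (Ne.symm h0), lt_of_le_of_ne ht₀.2 h1⟩
  have hloc : IsLocalMax F (t₀, x₀) :=
    hmax.isLocalMax (prod_mem_nhds (Icc_mem_nhds hIoo.1 hIoo.2) univ_mem)
  have hle := hv (τ + E) g f (hτ.add hEc) hg hf t₀ x₀ hIoo.1 hloc (hg2 _) (hf2 _)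
  -- The maximum of `F` is positive, so `v` exceeds the barrier at this point: the supersolution
  -- inequality is only needed where that happens.
  have hge := hsup t₀ hIoo x₀ (by linarith)
  have hd : deriv (τ + E) t₀ = deriv τ t₀ + γ * (Real.exp (N * (t₀ - T)) * N) := by
    rw [deriv_add (hτ.differentiable (by norm_num) _) (hEd t₀).differentiableAt, (hEd t₀).deriv]
  have : 0 < γ * (Real.exp (N * (t₀ - T)) * N) := by positivity
  rw [hd] at hle
  linarith

/-- A smooth convex approximation of the distance to `a` on the line. -/
noncomputable def smoothDist (r a s : ℝ) : ℝ := √((s - a) ^ 2 + r ^ 2)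

/-! ### The smoothed distance on the line -/

section smoothDist

variable {r a : ℝ}

theorem sq_smoothDist (r a s : ℝ) : smoothDist r a s ^ 2 = (s - a) ^ 2 + r ^ 2 :=
  Real.sq_sqrt (by positivity)

theorem smoothDist_nonneg (r a s : ℝ) : 0 ≤ smoothDist r a s := Real.sqrt_nonneg _

theorem abs_le_smoothDist (r a s : ℝ) : |s - a| ≤ smoothDist r a s :=
  Real.abs_le_sqrt (by nlinarith [sq_nonneg r])

theorem le_smoothDist (r a s : ℝ) : r ≤ smoothDist r a s :=
  Real.le_sqrt_of_sq_le (by nlinarith [sq_nonneg (s - a)])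

theorem smoothDist_pos (hr : 0 < r) (a s : ℝ) : 0 < smoothDist r a s :=
  hr.trans_le (le_smoothDist r a s)

theorem smoothDist_le (hr : 0 < r) (a s : ℝ) : smoothDist r a s ≤ |s - a| + r := by
  refine Real.sqrt_le_iff.2 ⟨by positivity, ?_⟩
  nlinarith [sq_abs (s - a), abs_nonneg (s - a), mul_nonneg (abs_nonneg (s - a)) hr.le]

theorem contDiff_smoothDist (hr : 0 < r) (a : ℝ) {n : WithTop ℕ∞} :
    ContDiff ℝ n (smoothDist r a) := by
  refine ContDiff.sqrt (((contDiff_id.sub contDiff_const).pow 2).add contDiff_const) fun s => ?_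
  exact (by positivity : (s - a) ^ 2 + r ^ 2 ≠ 0)

theorem hasDerivAt_smoothDist (hr : 0 < r) (a s : ℝ) :
    HasDerivAt (smoothDist r a) ((s - a) / smoothDist r a s) s := by
  have h1 : HasDerivAt (fun s : ℝ => (s - a) ^ 2 + r ^ 2) (2 * (s - a)) s := by
    simpa using (((hasDerivAt_id s).sub_const a).pow 2).add_const (r ^ 2)
  have h2 := h1.sqrt (by positivity)
  exact h2.congr_deriv (mul_div_mul_left _ _ two_ne_zero)

theorem deriv_smoothDist (hr : 0 < r) (a : ℝ) :
    deriv (smoothDist r a) = fun s => (s - a) / smoothDist r a s :=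
  funext fun s => (hasDerivAt_smoothDist hr a s).deriv

theorem deriv_deriv_smoothDist (hr : 0 < r) (a s : ℝ) :
    deriv (deriv (smoothDist r a)) s = r ^ 2 / smoothDist r a s ^ 3 := by
  have hp := smoothDist_pos hr a s
  rw [deriv_smoothDist hr]
  have := ((hasDerivAt_id s).sub_const a).div (hasDerivAt_smoothDist hr a s) hp.ne'
  refine this.deriv.trans ?_
  have h2 := sq_smoothDist r a s
  simp only [id]
  field_simp
  linarith

theorem abs_deriv_smoothDist_le (hr : 0 < r) (a s : ℝ) : |deriv (smoothDist r a) s| ≤ 1 := by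
  have hp := smoothDist_pos hr a s
  rw [deriv_smoothDist hr, abs_div, abs_of_pos hp, div_le_one hp]
  exact abs_le_smoothDist r a s

/-- Beyond distance `r` the smoothed distance is at most twice the true one. With the factor `θ₂ =
2` the slope term is then at least 1, the full oscillation of `c`. -/
theorem half_le_abs_deriv_smoothDist (hr : 0 < r) {a s : ℝ} (h : r ≤ |s - a|) :
    1 / 2 ≤ |deriv (smoothDist r a) s| := by
  have hp := smoothDist_pos hr a s
  rw [deriv_smoothDist hr, abs_div, abs_of_pos hp, le_div_iff₀ hp]
  linarith [smoothDist_le hr a s]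

theorem deriv_deriv_smoothDist_le (hr : 0 < r) (a s : ℝ) :
    deriv (deriv (smoothDist r a)) s ≤ 1 / r := by
  have hp := smoothDist_pos hr a s
  rw [deriv_deriv_smoothDist hr, div_le_div_iff₀ (by positivity) hr]
  have := pow_le_pow_left₀ hr.le (le_smoothDist r a s) 3
  linarith [pow_succ r 2]

theorem tendsto_smoothDist (r a : ℝ) : Tendsto (smoothDist r a) (cocompact ℝ) atTop := by
  refine tendsto_atTop_mono (fun s => ?_) (tendsto_atTop_add_const_right _ (-|a|)
    (tendsto_norm_cocompact_atTop (E := ℝ)))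
  have := abs_sub_abs_le_abs_sub s a
  have := abs_le_smoothDist r a s
  rw [Real.norm_eq_abs]
  linarith

theorem deriv_const_mul_smoothDist (hr : 0 < r) (a θ : ℝ) :
    deriv (fun s => θ * smoothDist r a s) = fun s => θ * deriv (smoothDist r a) s :=
  funext fun s => deriv_const_mul _ (hasDerivAt_smoothDist hr a s).differentiableAt

theorem deriv_deriv_const_mul_smoothDist (hr : 0 < r) (a θ s : ℝ) :
    deriv (deriv fun s => θ * smoothDist r a s) s = θ * deriv (deriv (smoothDist r a)) s := by
  rw [deriv_const_mul_smoothDist hr]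
  refine deriv_const_mul _ ?_
  have : ContDiff ℝ 1 (deriv (smoothDist r a)) :=
    ((contDiff_succ_iff_deriv (n := 1)).1 (contDiff_smoothDist hr a)).2.2
  exact this.differentiable (by norm_num) s

end smoothDist

/-! ### Upper bounds for subsolutions -/

section estimates

variable {i j : Fin 2} {c : Plane → ℝ} {ε : ℝ} {v : ℝ → Plane → ℝ}

/-- Comparison with `k t + θ₁ d(x_i, a) + θ₂ d(x_j, b)`, where `d` is the smooth distance. -/
theorem SeparableSubsolution.le_smoothDist_add (hij : i ≠ j) (hε : 0 < ε)
    (hv : SeparableSubsolution i j c ε v)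
    (hcont : ContinuousOn (fun z : ℝ × Plane => v z.1 z.2) (Set.Ici 0 ×ˢ Set.univ))
    (hbdd : ∀ T : ℝ, ∃ C : ℝ, ∀ t ∈ Set.Icc 0 T, ∀ x, |v t x| ≤ C) (hzero : ∀ x, v 0 x = 0)
    {k θ₁ θ₂ r₁ r₂ a b T T' : ℝ} (hr₁ : 0 < r₁) (hr₂ : 0 < r₂) (hθ₁ : 0 < θ₁) (hθ₁' : θ₁ ≤ 2)
    (hθ₂ : 0 < θ₂) (hθ₂' : θ₂ ≤ 2) (hTT' : T < T')
    (hsup : ∀ t ∈ Set.Ioo 0 T', ∀ x : Plane,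
      k * t + (θ₁ * smoothDist r₁ a (x i) + θ₂ * smoothDist r₂ b (x j)) < v t x →
      θ₁ + θ₁ * ε / r₁ + θ₂ * ε / r₂ + c (ε⁻¹ • x) ≤
        k + θ₂ * |deriv (smoothDist r₂ b) (x j)|)
    {t : ℝ} (ht : t ∈ Set.Icc 0 T) (x : Plane) :
    v t x ≤ k * t + (θ₁ * smoothDist r₁ a (x i) + θ₂ * smoothDist r₂ b (x j)) := by
  have habs : ∀ {θ r a : ℝ}, 0 < r → 0 < θ → ∀ s,
      |deriv (fun s => θ * smoothDist r a s) s| = θ * |deriv (smoothDist r a) s| := by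
    intro θ r a hr hθ s
    rw [deriv_const_mul_smoothDist hr, abs_mul, abs_of_pos hθ]
  have hslope : ∀ {θ r a : ℝ}, 0 < r → 0 < θ → ∀ s,
      |deriv (fun s => θ * smoothDist r a s) s| ≤ θ := by
    intro θ r a hr hθ s
    rw [habs hr hθ]
    exact mul_le_of_le_one_right hθ.le (abs_deriv_smoothDist_le hr a s)
  have hcurv : ∀ {θ r a : ℝ}, 0 < r → 0 < θ → ∀ s,
      ε * deriv (deriv fun s => θ * smoothDist r a s) s ≤ θ * ε / r := by
    intro θ r a hr hθ s
    rw [deriv_deriv_const_mul_smoothDist hr]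
    have := mul_le_mul_of_nonneg_left (deriv_deriv_smoothDist_le hr a s) (mul_pos hε hθ).le
    calc _ = ε * θ * deriv (deriv (smoothDist r a)) s := by ring
      _ ≤ _ := this
      _ = _ := by ring
  refine hv.le_of_supersolution hij hcont hbdd hzero (τ := fun t => k * t)
    (g := fun s => θ₁ * smoothDist r₁ a s) (f := fun s => θ₂ * smoothDist r₂ b s)
    (contDiff_const.mul contDiff_id) (contDiff_const.mul (contDiff_smoothDist hr₁ a))
    (contDiff_const.mul (contDiff_smoothDist hr₂ b)) (fun s => (hslope hr₁ hθ₁ s).trans hθ₁')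
    (fun s => (hslope hr₂ hθ₂ s).trans hθ₂') ((tendsto_smoothDist r₁ a).const_mul_atTop hθ₁)
    ((tendsto_smoothDist r₂ b).const_mul_atTop hθ₂) (fun x => ?_) hTT' (fun t ht x hx => ?_) ht x
  · have := smoothDist_nonneg r₁ a (x i)
    have := smoothDist_nonneg r₂ b (x j)
    rw [mul_zero]
    positivity
  · have h1 := hsup t ht x hx
    have h2 := hslope (a := a) hr₁ hθ₁ (x i)
    have h3 := hcurv (a := a) hr₁ hθ₁ (x i)
    have h4 := hcurv (a := b) hr₂ hθ₂ (x j)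
    have h5 : deriv (fun t : ℝ => k * t) t = k := by
      simp
    rw [h5, habs hr₂ hθ₂, mul_add]
    linarith

/-- A cone of small slope `θ` is a barrier at the cost of a speed increase proportional to `θ`; let
`θ` tend to 0. The bound serves to discard the region beyond the ends of a strip. -/
theorem SeparableSubsolution.le_half_mul (hij : i ≠ j) (hε : 0 < ε)
    (hv : SeparableSubsolution i j c ε v)
    (hcont : ContinuousOn (fun z : ℝ × Plane => v z.1 z.2) (Set.Ici 0 ×ˢ Set.univ))
    (hbdd : ∀ T : ℝ, ∃ C : ℝ, ∀ t ∈ Set.Icc 0 T, ∀ x, |v t x| ≤ C) (hzero : ∀ x, v 0 x = 0)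
    (hc : ∀ y, c y ≤ 1 / 2) {t : ℝ} (ht : 0 ≤ t) (x : Plane) : v t x ≤ 1 / 2 * t := by
  have key : ∀ θ ∈ Set.Ioc (0 : ℝ) 2, v t x ≤ (1 / 2 + (θ + 2 * θ * ε)) * t +
      (θ * smoothDist 1 0 (x i) + θ * smoothDist 1 0 (x j)) := by
    intro θ hθ
    refine hv.le_smoothDist_add hij hε hcont hbdd hzero one_pos one_pos hθ.1 hθ.2 hθ.1 hθ.2
      (lt_add_one t) (fun s hs y _ => ?_) ⟨ht, le_rfl⟩ x
    have h1 := hc (ε⁻¹ • y)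
    have h2 := mul_nonneg hθ.1.le (abs_nonneg (deriv (smoothDist 1 0) (y j)))
    linarith
  have hlim : Tendsto (fun θ : ℝ => (1 / 2 + (θ + 2 * θ * ε)) * t +
      (θ * smoothDist 1 0 (x i) + θ * smoothDist 1 0 (x j))) (𝓝[>] 0) (𝓝 (1 / 2 * t)) := by
    have : Continuous (fun θ : ℝ => (1 / 2 + (θ + 2 * θ * ε)) * t +
      (θ * smoothDist 1 0 (x i) + θ * smoothDist 1 0 (x j))) := by fun_prop
    simpa using (this.tendsto 0).mono_left nhdsWithin_le_nhds
  exact ge_of_tendsto hlim (eventually_of_mem (Ioc_mem_nhdsGT two_pos) key)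

/-- If `c = -1/2` on a long strip of direction `i` that passes near the origin, of width large
compared with `ε`, then a subsolution is almost as small as possible at the origin. -/
theorem SeparableSubsolution.le_of_strip (hij : i ≠ j) (hε : 0 < ε)
    (hv : SeparableSubsolution i j c ε v)
    (hcont : ContinuousOn (fun z : ℝ × Plane => v z.1 z.2) (Set.Ici 0 ×ˢ Set.univ))
    (hbdd : ∀ T : ℝ, ∃ C : ℝ, ∀ t ∈ Set.Icc 0 T, ∀ x, |v t x| ≤ C) (hzero : ∀ x, v 0 x = 0)
    (hc : ∀ y, c y ≤ 1 / 2) {η a b κ : ℝ} (hη : 0 < η) (hη' : η < 1 / 2) (ha : |a| ≤ κ)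
    (hb : |b| ≤ κ) (hstrip : ∀ x : Plane, |x i - a| ≤ 7 / η → |x j - b| ≤ 7 * ε / η →
      c (ε⁻¹ • x) ≤ -(1 / 2)) :
    v 1 0 ≤ -(1 / 2) + 9 / 10 * η + (η / 3 * (κ + 2 * ε) + 2 * (κ + 7 * ε / η)) := by
  have hr₂ : 0 < 7 * ε / η := by positivity
  -- On the strip the errors are `η/3` (slope along it), `η/6` and `2η/7` (diffusion), with sum
  -- below `9/10 * η`. Off the strip sideways, slope 2 gains at least 1, which pays for `c` rising
  -- from `-1/2` to `1/2`.
  have h := hv.le_smoothDist_add (k := -(1 / 2) + 9 / 10 * η) (θ₁ := η / 3) (θ₂ := 2)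
    (r₁ := 2 * ε) (r₂ := 7 * ε / η) (a := a) (b := b) (T := 1) (T' := 2) hij hε hcont hbdd hzero
    (by positivity) hr₂ (by positivity) (by linarith) two_pos le_rfl (by norm_num)
    (fun t ht x hx => ?_) (t := 1) ⟨zero_le_one, le_rfl⟩ 0
  · refine h.trans ?_
    have h1 := smoothDist_le (mul_pos two_pos hε) a ((0 : Plane) i)
    have h2 := smoothDist_le hr₂ b ((0 : Plane) j)
    simp only [PiLp.zero_apply, zero_sub, abs_neg] at h1 h2 ⊢
    have h3 := mul_le_mul_of_nonneg_left (h1.trans (add_le_add_left ha _))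
      (div_pos hη three_pos).le
    linarith
  · have e1 : η / 3 * ε / (2 * ε) = η / 6 := by field_simp; norm_num
    have e2 : 2 * ε / (7 * ε / η) = 2 * η / 7 := by field_simp
    rw [e1, e2]
    -- Beyond the ends the cone is at least `7/3`, and `7/3 - t/2 > t/2` for `t < 2`: the barrier
    -- already lies above the a priori bound there, so nothing has to be checked.
    have hxi : |x i - a| ≤ 7 / η := by
      by_contra! hlt
      have h1 := hv.le_half_mul hij hε hcont hbdd hzero hc ht.1.le x
      have h2 : η / 3 * (7 / η) ≤ η / 3 * smoothDist (2 * ε) a (x i) :=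
        mul_le_mul_of_nonneg_left (hlt.le.trans (abs_le_smoothDist _ _ _)) (by positivity)
      have h3 : η / 3 * (7 / η) = 7 / 3 := by field_simp
      have h4 := smoothDist_nonneg (7 * ε / η) b (x j)
      have h5 := ht.2
      have h6 := mul_pos hη ht.1
      nlinarith
    rcases le_total |x j - b| (7 * ε / η) with hxj | hxj
    · have h1 := hstrip x hxi hxj
      have h2 := abs_nonneg (deriv (smoothDist (7 * ε / η) b) (x j))
      linarith
    · have h1 := half_le_abs_deriv_smoothDist hr₂ hxj
      have h2 := hc (ε⁻¹ • x)
      linarith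

end estimates

/-! ### The Lipschitz regularization -/

section lipschitzRegularization

open Classical in
/-- The third phase of the construction of the environment, for an arbitrary weight `w`. -/
noncomputable def lipschitzRegularization (w : Plane → ℝ) (x : Plane) : ℝ :=
  if 0 ≤ w x then max (⨅ y : Plane, (w y + dist x y)) 0
  else min (⨆ y : Plane, (w y - dist x y)) 0

theorem weight_eq_lipschitzRegularization (lam mu : ℝ) (ξ : Site → Bool) :
    weight lam mu ξ = lipschitzRegularization (weight2 lam mu ξ) := by
  funext x
  unfold weight lipschitzRegularization
  congr

variable {w : Plane → ℝ}

theorem bddBelow_add_dist (hw : ∀ y, |w y| ≤ 1 / 2) (x : Plane) :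
    BddBelow (Set.range fun y => w y + dist x y) := by
  refine ⟨-(1 / 2), ?_⟩
  rintro _ ⟨y, rfl⟩
  linarith [(abs_le.1 (hw y)).1, dist_nonneg (x := x) (y := y)]

theorem bddAbove_sub_dist (hw : ∀ y, |w y| ≤ 1 / 2) (x : Plane) :
    BddAbove (Set.range fun y => w y - dist x y) := by
  refine ⟨1 / 2, ?_⟩
  rintro _ ⟨y, rfl⟩
  linarith [(abs_le.1 (hw y)).2, dist_nonneg (x := x) (y := y)]

theorem iInf_add_dist_le (hw : ∀ y, |w y| ≤ 1 / 2) (x y : Plane) :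
    ⨅ y, (w y + dist x y) ≤ w y + dist x y :=
  ciInf_le (bddBelow_add_dist hw x) y

theorem le_iSup_sub_dist (hw : ∀ y, |w y| ≤ 1 / 2) (x y : Plane) :
    w y - dist x y ≤ ⨆ y, (w y - dist x y) :=
  le_ciSup (bddAbove_sub_dist hw x) y

theorem iInf_add_dist_le_add (hw : ∀ y, |w y| ≤ 1 / 2) (x x' : Plane) :
    ⨅ y, (w y + dist x y) ≤ (⨅ y, (w y + dist x' y)) + dist x x' := by
  rw [← sub_le_iff_le_add]
  refine le_ciInf fun y => ?_
  linarith [iInf_add_dist_le hw x y, dist_triangle x x' y]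

theorem iSup_sub_dist_le_add (hw : ∀ y, |w y| ≤ 1 / 2) (x x' : Plane) :
    ⨆ y, (w y - dist x y) ≤ (⨆ y, (w y - dist x' y)) + dist x x' := by
  refine ciSup_le fun y => ?_
  linarith [le_iSup_sub_dist hw x' y, dist_triangle x' x y, dist_comm x x']

theorem abs_lipschitzRegularization_le (hw : ∀ y, |w y| ≤ 1 / 2) (x : Plane) :
    |lipschitzRegularization w x| ≤ 1 / 2 := by
  have h := abs_le.1 (hw x)
  unfold lipschitzRegularization
  split_ifs with hx
  · have h1 := iInf_add_dist_le hw x x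
    rw [dist_self, add_zero] at h1
    exact abs_le.2 ⟨le_trans (by norm_num) (le_max_right _ _),
      max_le (h1.trans h.2) (by norm_num)⟩
  · have h1 := le_iSup_sub_dist hw x x
    rw [dist_self, sub_zero] at h1
    exact abs_le.2 ⟨le_min (h.1.trans h1) (by norm_num),
      le_trans (min_le_right _ _) (by norm_num)⟩

theorem lipschitzRegularization_sub_le (hw : ∀ y, |w y| ≤ 1 / 2) (x x' : Plane) :
    lipschitzRegularization w x - lipschitzRegularization w x' ≤ dist x x' := by
  have hd := dist_nonneg (x := x) (y := x')
  unfold lipschitzRegularization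
  split_ifs with h h' h'
  · rw [sub_le_iff_le_add]
    refine max_le ?_ (add_nonneg hd (le_max_right _ _))
    linarith [iInf_add_dist_le_add hw x x', le_max_left (⨅ y, (w y + dist x' y)) 0]
  -- Opposite signs: evaluating the infimum and the supremum at `x'` bounds their difference by the
  -- distance. When one of them is cut off at 0, the signs of `w x` and `w x'` suffice.
  · have h1 := iInf_add_dist_le hw x x'
    have h2 := le_iSup_sub_dist hw x' x
    rw [dist_comm] at h2
    have h3 := le_iSup_sub_dist hw x' x'
    rw [dist_self] at h3
    rcases max_cases (⨅ y, (w y + dist x y)) 0 with ⟨e, -⟩ | ⟨e, -⟩ <;>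
      rcases min_cases (⨆ y, (w y - dist x' y)) 0 with ⟨e', -⟩ | ⟨e', -⟩ <;>
      rw [e, e'] <;> linarith
  · have h1 := min_le_right (⨆ y, (w y - dist x y)) 0
    have h2 := le_max_right (⨅ y, (w y + dist x' y)) 0
    linarith
  · rw [sub_le_iff_le_add', ← min_add_add_right]
    exact min_le_min (iSup_sub_dist_le_add hw x x') (by simp)

theorem lipschitzWith_lipschitzRegularization (hw : ∀ y, |w y| ≤ 1 / 2) :
    LipschitzWith 1 (lipschitzRegularization w) :=
  LipschitzWith.of_le_add fun x y => by linarith [lipschitzRegularization_sub_le hw x y]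

/-- The values of `w` differ by at most 1 and the cones have slope 1, so points at distance at least
1 have no influence. -/
theorem lipschitzRegularization_le_neg_half (hw : ∀ y, |w y| ≤ 1 / 2) {x : Plane}
    (h : ∀ y, dist x y < 1 → w y ≤ -(1 / 2)) : lipschitzRegularization w x ≤ -(1 / 2) := by
  have hx := h x (by simp)
  rw [lipschitzRegularization, if_neg (by linarith)]
  refine (min_le_left _ _).trans (ciSup_le fun y => ?_)
  rcases lt_or_ge (dist x y) 1 with hy | hy
  · linarith [h y hy, dist_nonneg (x := x) (y := y)]
  · linarith [(abs_le.1 (hw y)).2]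

theorem half_le_lipschitzRegularization (hw : ∀ y, |w y| ≤ 1 / 2) {x : Plane}
    (h : ∀ y, dist x y < 1 → 1 / 2 ≤ w y) : 1 / 2 ≤ lipschitzRegularization w x := by
  have hx := h x (by simp)
  rw [lipschitzRegularization, if_pos (by linarith)]
  refine (le_ciInf fun y => ?_).trans (le_max_left _ _)
  rcases lt_or_ge (dist x y) 1 with hy | hy
  · linarith [h y hy, dist_nonneg (x := x) (y := y)]
  · linarith [(abs_le.1 (hw y)).1]

/-- The regularization has range 1: a point at distance at least 1 cannot beat the competitor `y =
x`. This locality underlies the measurability of the field. -/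
theorem lipschitzRegularization_congr {w' : Plane → ℝ} (hw : ∀ y, |w y| ≤ 1 / 2)
    (hw' : ∀ y, |w' y| ≤ 1 / 2) {x : Plane} (h : ∀ y, dist x y < 1 → w y = w' y) :
    lipschitzRegularization w x = lipschitzRegularization w' x := by
  have hinf : ∀ {w w' : Plane → ℝ}, (∀ y, |w y| ≤ 1 / 2) → (∀ y, |w' y| ≤ 1 / 2) →
      (∀ y, dist x y < 1 → w y = w' y) → ⨅ y, (w y + dist x y) ≤ ⨅ y, (w' y + dist x y) := by
    intro w w' hw hw' h
    refine le_ciInf fun y => ?_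
    rcases lt_or_ge (dist x y) 1 with hy | hy
    · exact (iInf_add_dist_le hw x y).trans_eq (by rw [h y hy])
    · have := iInf_add_dist_le hw x x
      rw [dist_self] at this
      linarith [(abs_le.1 (hw x)).2, (abs_le.1 (hw' y)).1]
  have hsup : ∀ {w w' : Plane → ℝ}, (∀ y, |w y| ≤ 1 / 2) → (∀ y, |w' y| ≤ 1 / 2) →
      (∀ y, dist x y < 1 → w y = w' y) → ⨆ y, (w y - dist x y) ≤ ⨆ y, (w' y - dist x y) := by
    intro w w' hw hw' h
    refine ciSup_le fun y => ?_
    rcases lt_or_ge (dist x y) 1 with hy | hy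
    · exact Eq.trans_le (by rw [h y hy]) (le_iSup_sub_dist hw' x y)
    · have := le_iSup_sub_dist hw' x x
      rw [dist_self] at this
      linarith [(abs_le.1 (hw y)).2, (abs_le.1 (hw' x)).1]
  have h' : ∀ y, dist x y < 1 → w' y = w y := fun y hy => (h y hy).symm
  unfold lipschitzRegularization
  rw [h x (by simp), le_antisymm (hinf hw hw' h) (hinf hw' hw h'),
    le_antisymm (hsup hw hw' h) (hsup hw' hw h')]

theorem lipschitzRegularization_comp_add (w : Plane → ℝ) (z x : Plane) :
    lipschitzRegularization (fun y => w (y + z)) x = lipschitzRegularization w (x + z) := by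
  have h1 : ⨅ y, (w (y + z) + dist x y) = ⨅ y, (w y + dist (x + z) y) :=
    Equiv.iInf_congr (Equiv.addRight z) fun y => by simp
  have h2 : ⨆ y, (w (y + z) - dist x y) = ⨆ y, (w y - dist (x + z) y) :=
    Equiv.iSup_congr (Equiv.addRight z) fun y => by simp
  unfold lipschitzRegularization
  rw [h1, h2]

end lipschitzRegularization

/-! ### Deterministic properties of the environment -/

section weight

variable {lam mu : ℝ} {ξ ξ' : Site → Bool}

theorem abs_weight2_le (lam mu : ℝ) (ξ : Site → Bool) (x : Plane) :
    |weight2 lam mu ξ x| ≤ 1 / 2 := by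
  unfold weight2 weight1
  split_ifs <;> norm_num [abs_of_pos]

theorem abs_weight_le (lam mu : ℝ) (ξ : Site → Bool) (x : Plane) :
    |weight lam mu ξ x| ≤ 1 / 2 := by
  rw [weight_eq_lipschitzRegularization]
  exact abs_lipschitzRegularization_le (abs_weight2_le lam mu ξ) x

theorem lipschitzWith_weight (lam mu : ℝ) (ξ : Site → Bool) :
    LipschitzWith 1 (weight lam mu ξ) := by
  rw [weight_eq_lipschitzRegularization]
  exact lipschitzWith_lipschitzRegularization (abs_weight2_le lam mu ξ)

theorem weight2_congr {x x' : Plane}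
    (hH : ∀ k, InHorizontal lam mu ξ k x ↔ InHorizontal lam mu ξ' k x')
    (hV : ∀ k, InVertical lam mu ξ k x ↔ InVertical lam mu ξ' k x') :
    weight2 lam mu ξ x = weight2 lam mu ξ' x' := by
  unfold weight2 weight1
  classical
  refine if_congr ?_ rfl (if_congr ?_ rfl (if_congr ?_ rfl rfl)) <;> simp only [hH, hV]

theorem weight_congr {x : Plane}
    (hH : ∀ k y, dist x y < 1 → (InHorizontal lam mu ξ k y ↔ InHorizontal lam mu ξ' k y))
    (hV : ∀ k y, dist x y < 1 → (InVertical lam mu ξ k y ↔ InVertical lam mu ξ' k y)) :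
    weight lam mu ξ x = weight lam mu ξ' x := by
  simp only [weight_eq_lipschitzRegularization]
  exact lipschitzRegularization_congr (abs_weight2_le lam mu ξ) (abs_weight2_le lam mu ξ')
    fun y hy => weight2_congr (fun k => hH k y hy) fun k => hV k y hy

/-- Any vertical rectangle through `x` has level below `k`, and the horizontal rectangle of level
`k` protects `x` from it. -/
theorem weight2_eq_neg_half {k : ℕ+} {x : Plane} (hH : InHorizontal lam mu ξ k x)
    (hV : ∀ k', k ≤ k' → ¬ InVertical lam mu ξ k' x) : weight2 lam mu ξ x = -(1 / 2) := by
  rw [weight2, if_neg, if_neg, weight1, if_pos ⟨k, hH⟩]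
  · rintro ⟨k', h1, -, h3⟩
    exact h3 k (not_le.1 fun h => hV k' h h1) hH
  · rintro ⟨k', h1, h3⟩
    exact h3 k (not_le.1 fun h => hV k' h h1).le hH

theorem weight2_eq_half {k : ℕ+} {x : Plane} (hV : InVertical lam mu ξ k x)
    (hH : ∀ k', k ≤ k' → ¬ InHorizontal lam mu ξ k' x) : weight2 lam mu ξ x = 1 / 2 := by
  rw [weight2, if_pos ⟨k, hV, hH⟩]

theorem abs_coord_sub_le (x y : Plane) (i : Fin 2) : |x i - y i| ≤ dist x y := by
  rw [dist_eq_norm, ← Real.norm_eq_abs, ← PiLp.sub_apply]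
  exact PiLp.norm_apply_le _ i

/-- Near the origin, at scale `2 ^ k`, there is a horizontal rectangle of level `k`, and no vertical
rectangle of a level `k' ≥ k` comes close to it. -/
def HasStrip (κ R : ℝ) (ξ : Site → Bool) (k : ℕ+) : Prop :=
  (∃ l m : ℤ, |(l : ℝ)| ≤ κ * 2 ^ (k : ℕ) ∧ |(m : ℝ)| ≤ κ * 2 ^ (k : ℕ) ∧ ξ (0, k, l, m) = true) ∧
  ∀ (k' : ℕ+) (l m : ℤ), k ≤ k' → |(l : ℝ)| ≤ R * 2 ^ (k : ℕ) → |(m : ℝ)| ≤ R * 2 ^ (k' : ℕ) →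
    ξ (1, k', l, m) = false

/-- The symmetry of the set of sites that exchanges the two coordinates. -/
def siteSwap (i : Site) : Site := (1 - i.1, i.2.1, i.2.2.2, i.2.2.1)

theorem pnat_two_pow_le {k k' : ℕ+} (h : k ≤ k') : (2 : ℝ) ^ (k : ℕ) ≤ 2 ^ (k' : ℕ) :=
  pow_le_pow_right₀ one_le_two h

theorem two_le_two_pow (k : ℕ+) : (2 : ℝ) ≤ 2 ^ (k : ℕ) := by
  exact (pow_one (2 : ℝ)).symm.trans_le (pow_le_pow_right₀ one_le_two k.pos)

/-- Two rectangles with a common point have close centres; the product `d * e` matches the windows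
`R * 2 ^ k` of `HasStrip`. -/
theorem abs_le_of_two_rectangles {a b c d e l l' y : ℝ} (h1 : |y - l| ≤ a) (h2 : |y - l'| ≤ b)
    (h3 : |l| ≤ c) (h : a + b + c ≤ d * e) : |l'| ≤ d * e := by
  rw [abs_le] at *
  constructor <;> linarith

/-- The radius `R = κ + lam + mu + 1` is large enough for every vertical rectangle of level at least
`k` meeting the horizontal one to have its centre in the window that `HasStrip` keeps empty. The
regularization costs a margin of 1 on each side, whence `- 1` in place of `+ 1` in the sizes. -/
theorem HasStrip.exists_weight_le {κ : ℝ} (hlam : 0 ≤ lam) (hmu : 0 ≤ mu) {k : ℕ+}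
    (h : HasStrip κ (κ + lam + mu + 1) ξ k) :
    ∃ l m : ℤ, |(l : ℝ)| ≤ κ * 2 ^ (k : ℕ) ∧ |(m : ℝ)| ≤ κ * 2 ^ (k : ℕ) ∧
      ∀ x : Plane, |x 0 - l| ≤ (lam * 2 ^ (k : ℕ) - 1) / 2 → |x 1 - m| ≤ (mu - 1) / 2 →
        weight lam mu ξ x ≤ -(1 / 2) := by
  obtain ⟨⟨l, m, hl, hm, hξ⟩, hno⟩ := h
  refine ⟨l, m, hl, hm, fun x hx0 hx1 => ?_⟩
  rw [weight_eq_lipschitzRegularization]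
  refine lipschitzRegularization_le_neg_half (abs_weight2_le lam mu ξ) fun y hy => ?_
  have h0 : |y 0 - l| ≤ (lam * 2 ^ (k : ℕ) + 1) / 2 := by
    have := abs_coord_sub_le x y 0
    rw [abs_le] at *
    constructor <;> linarith
  have h1 : |y 1 - m| ≤ (mu + 1) / 2 := by
    have := abs_coord_sub_le x y 1
    rw [abs_le] at *
    constructor <;> linarith
  refine (weight2_eq_neg_half ⟨l, m, hξ, h0, h1⟩ ?_).le
  rintro k' hk' ⟨l', m', hξ', h0', h1'⟩
  have hT := two_le_two_pow k
  have hTT := pnat_two_pow_le hk'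
  have hκ : 0 ≤ κ := by
    by_contra! hκ
    nlinarith [abs_nonneg (l : ℝ)]
  have hmT : mu * 2 ≤ mu * 2 ^ (k : ℕ) := mul_le_mul_of_nonneg_left hT hmu
  have hlT : 0 ≤ lam * 2 ^ (k : ℕ) := by positivity
  refine Bool.false_ne_true ((hno k' l' m' hk' ?_ ?_).symm.trans hξ')
  · refine abs_le_of_two_rectangles h0 h0' hl ?_
    nlinarith
  · refine abs_le_of_two_rectangles h1 h1' hm ?_
    have e1 := mul_le_mul_of_nonneg_left hTT hκ
    have e2 := mul_le_mul_of_nonneg_left hTT hmu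
    have e3 : 0 ≤ lam * 2 ^ (k' : ℕ) := by positivity
    nlinarith

theorem HasStrip.exists_le_weight {κ : ℝ} (hlam : 0 ≤ lam) (hmu : 0 ≤ mu) {k : ℕ+}
    (h : HasStrip κ (κ + lam + mu + 1) (ξ ∘ siteSwap) k) :
    ∃ l m : ℤ, |(l : ℝ)| ≤ κ * 2 ^ (k : ℕ) ∧ |(m : ℝ)| ≤ κ * 2 ^ (k : ℕ) ∧
      ∀ x : Plane, |x 1 - l| ≤ (lam * 2 ^ (k : ℕ) - 1) / 2 → |x 0 - m| ≤ (mu - 1) / 2 →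
        1 / 2 ≤ weight lam mu ξ x := by
  obtain ⟨⟨l, m, hl, hm, hξ⟩, hno⟩ := h
  refine ⟨l, m, hl, hm, fun x hx0 hx1 => ?_⟩
  rw [weight_eq_lipschitzRegularization]
  refine half_le_lipschitzRegularization (abs_weight2_le lam mu ξ) fun y hy => ?_
  have h0 : |y 1 - l| ≤ (lam * 2 ^ (k : ℕ) + 1) / 2 := by
    have := abs_coord_sub_le x y 1
    rw [abs_le] at *
    constructor <;> linarith
  have h1 : |y 0 - m| ≤ (mu + 1) / 2 := by
    have := abs_coord_sub_le x y 0
    rw [abs_le] at *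
    constructor <;> linarith
  refine (weight2_eq_half ⟨m, l, hξ, h1, h0⟩ ?_).ge
  rintro k' hk' ⟨m', l', hξ', h1', h0'⟩
  have hT := two_le_two_pow k
  have hTT := pnat_two_pow_le hk'
  have hκ : 0 ≤ κ := by
    by_contra! hκ
    nlinarith [abs_nonneg (l : ℝ)]
  have hmT : mu * 2 ≤ mu * 2 ^ (k : ℕ) := mul_le_mul_of_nonneg_left hT hmu
  have hlT : 0 ≤ lam * 2 ^ (k : ℕ) := by positivity
  refine Bool.false_ne_true ((hno k' l' m' hk' ?_ ?_).symm.trans hξ')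
  · refine abs_le_of_two_rectangles h0 h0' hl ?_
    nlinarith
  · refine abs_le_of_two_rectangles h1 h1' hm ?_
    have e1 := mul_le_mul_of_nonneg_left hTT hκ
    have e2 := mul_le_mul_of_nonneg_left hTT hmu
    have e3 : 0 ≤ lam * 2 ^ (k' : ℕ) := by positivity
    nlinarith

/-- The translation of a configuration by `-(a, b)`. -/
def shift (n : ℤ × ℤ) (ξ : Site → Bool) : Site → Bool :=
  fun i => ξ (i.1, i.2.1, i.2.2.1 + n.1, i.2.2.2 + n.2)

/-- The lattice point with given integer coordinates. -/
noncomputable def latticePoint (n : ℤ × ℤ) : Plane := !₂[(n.1 : ℝ), (n.2 : ℝ)]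

theorem inHorizontal_shift (n : ℤ × ℤ) (k : ℕ+) (x : Plane) :
    InHorizontal lam mu (shift n ξ) k x ↔ InHorizontal lam mu ξ k (x + latticePoint n) := by
  constructor
  · rintro ⟨l, m, h, h0, h1⟩
    refine ⟨l + n.1, m + n.2, h, ?_, ?_⟩ <;> simpa [latticePoint, add_sub_add_right_eq_sub]
  · rintro ⟨l, m, h, h0, h1⟩
    refine ⟨l - n.1, m - n.2, by simpa [shift] using h, ?_, ?_⟩
    · simpa [latticePoint, sub_sub_eq_add_sub] using h0
    · simpa [latticePoint, sub_sub_eq_add_sub] using h1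

theorem inVertical_shift (n : ℤ × ℤ) (k : ℕ+) (x : Plane) :
    InVertical lam mu (shift n ξ) k x ↔ InVertical lam mu ξ k (x + latticePoint n) := by
  constructor
  · rintro ⟨l, m, h, h0, h1⟩
    refine ⟨l + n.1, m + n.2, h, ?_, ?_⟩ <;> simpa [latticePoint, add_sub_add_right_eq_sub]
  · rintro ⟨l, m, h, h0, h1⟩
    refine ⟨l - n.1, m - n.2, by simpa [shift] using h, ?_, ?_⟩
    · simpa [latticePoint, sub_sub_eq_add_sub] using h0
    · simpa [latticePoint, sub_sub_eq_add_sub] using h1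

theorem weight_shift (lam mu : ℝ) (n : ℤ × ℤ) (ξ : Site → Bool) (x : Plane) :
    weight lam mu (shift n ξ) x = weight lam mu ξ (x + latticePoint n) := by
  simp only [weight_eq_lipschitzRegularization]
  rw [← lipschitzRegularization_comp_add]
  congr 1
  funext y
  exact weight2_congr (fun k => inHorizontal_shift n k y) fun k => inVertical_shift n k y

end weight

theorem tendsto_two_pow_inv_pnat :
    Tendsto (fun k : ℕ+ => ((2 : ℝ) ^ (k : ℕ))⁻¹) atTop (𝓝[>] 0) := by
  refine tendsto_nhdsWithin_iff.2 ⟨?_, Eventually.of_forall fun k => ?_⟩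
  · have h1 : Tendsto (fun k : ℕ+ => (k : ℕ)) atTop atTop :=
      tendsto_atTop.2 fun n => (eventually_ge_atTop n.succPNat).mono fun k hk =>
        (Nat.le_succ n).trans hk
    have h2 : Tendsto (fun n : ℕ => (2 : ℝ) ^ n) atTop atTop :=
      tendsto_pow_atTop_atTop_of_one_lt one_lt_two
    exact (h2.comp h1).inv_tendsto_atTop
  · exact Set.mem_Ioi.2 (by positivity)

/-! ### From strips to oscillation of the solutions -/

section strip

variable {lam mu η : ℝ} {ξ : Site → Bool} {θ : Plane} {i j : Fin 2} {c : Plane → ℝ}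

/-- After scaling by `ε` the box has half-length `(lam - ε) / 2 ≥ 7 / η` and half-width `ε * (mu -
1) / 2 ≥ 7 * ε / η`; the constant 16 leaves room for the lost margin because `1 ≤ 1 / η`. The offset
`θ` moves the centre by at most `ε`, and `ε ≤ η ^ 2 / 1000` makes the remaining errors fit into `η /
10`. -/
theorem SeparableSubsolution.le_of_box (hij : i ≠ j) (hη : 0 < η) (hη' : η < 1 / 2)
    (hlam : 16 / η ≤ lam) (hmu : 16 / η ≤ mu) (hθ : ∀ i, |θ i| ≤ 1) {ε : ℝ} (hε : 0 < ε)
    (hε' : ε ≤ η ^ 2 / 1000) {v : ℝ → Plane → ℝ} (hv : SeparableSubsolution i j c ε v)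
    (hcont : ContinuousOn (fun z : ℝ × Plane => v z.1 z.2) (Set.Ici 0 ×ˢ Set.univ))
    (hbdd : ∀ T : ℝ, ∃ C : ℝ, ∀ t ∈ Set.Icc 0 T, ∀ x, |v t x| ≤ C) (hzero : ∀ x, v 0 x = 0)
    (hc : ∀ y, c y ≤ 1 / 2) {l m : ℝ} (hl : |l| ≤ η / 100 * ε⁻¹) (hm : |m| ≤ η / 100 * ε⁻¹)
    (hbox : ∀ y : Plane, |(y + θ) i - l| ≤ (lam * ε⁻¹ - 1) / 2 → |(y + θ) j - m| ≤ (mu - 1) / 2 →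
      c y ≤ -(1 / 2)) :
    v 1 0 ≤ -(1 / 2) + η := by
  have hT : 0 < ε⁻¹ := inv_pos.2 hε
  have hscale : ∀ n s : ℝ, |n| ≤ η / 100 * ε⁻¹ → |s| ≤ 1 → |ε * (n - s)| ≤ η / 100 + ε := by
    intro n s hn hs
    rw [abs_mul, abs_of_pos hε]
    calc ε * |n - s| ≤ ε * (η / 100 * ε⁻¹ + 1) :=
          mul_le_mul_of_nonneg_left ((abs_sub n s).trans (add_le_add hn hs)) hε.le
      _ = _ := by field_simp
  have hcoord : ∀ (x : Plane) (k : Fin 2) (n : ℝ),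
      |(ε⁻¹ • x + θ) k - n| = ε⁻¹ * |x k - ε * (n - θ k)| := by
    intro x k n
    rw [← abs_of_pos hT, ← abs_mul, abs_of_pos hT]
    congr 1
    simp only [PiLp.add_apply, PiLp.smul_apply, smul_eq_mul]
    field_simp
    ring
  have hη1 : 1 ≤ 1 / η := by rw [le_div_iff₀ hη]; linarith
  have hε1 : 1 ≤ ε⁻¹ := by
    rw [one_le_inv₀ hε]
    nlinarith
  have h := hv.le_of_strip hij hε hcont hbdd hzero hc hη hη' (hscale l (θ i) hl (hθ i))
    (hscale m (θ j) hm (hθ j)) fun x hxi hxj => ?_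
  · have e : 7 * ε / η ≤ 7 / 1000 * η := by
      rw [div_le_iff₀ hη]
      nlinarith
    have e2 : ε ≤ η / 2000 := by nlinarith
    have e3 : η / 3 * (η / 100 + ε + 2 * ε) ≤ 1 / 6 * (η / 100 + ε + 2 * ε) :=
      mul_le_mul_of_nonneg_right (by linarith) (by positivity)
    linarith
  · refine hbox _ ?_ ?_
    · rw [hcoord]
      have h1 := mul_le_mul_of_nonneg_left hxi hT.le
      have h2 : 16 * (1 / η) ≤ lam := by rwa [mul_one_div]
      have h3 : ε⁻¹ * (7 / η) = 7 * ((1 / η) * ε⁻¹) := by ring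
      have h4 := mul_le_mul_of_nonneg_right h2 hT.le
      have h5 := mul_le_mul_of_nonneg_right hη1 hT.le
      linarith
    · rw [hcoord]
      have h1 := mul_le_mul_of_nonneg_left hxj hT.le
      have h2 : 16 * (1 / η) ≤ mu := by rwa [mul_one_div]
      have h3 : ε⁻¹ * (7 * ε / η) = 7 * (1 / η) := by field_simp
      linarith

variable {h : Plane → ℝ} {u : ℝ → ℝ → Plane → ℝ}

/-- Each good level `k` is used at the scale `ε = 2 ^ (-k)`. The offset `θ` is 0 for the lattice
environment and a point of the unit square for the field stationary under all translations. -/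
theorem IsSolutionFamily.frequently_le (hη : 0 < η) (hη' : η < 1 / 2)
    (hlam : 16 / η ≤ lam) (hmu : 16 / η ≤ mu) (hθ : ∀ i, |θ i| ≤ 1)
    (hh : ∀ p : Plane, |p 0| ≤ 2 → |p 1| ≤ 2 → h p = |p 1| - |p 0|)
    (hu : IsSolutionFamily h (fun y => weight lam mu ξ (y + θ)) u)
    (hstrip : ∃ᶠ k in atTop, HasStrip (η / 100) (η / 100 + lam + mu + 1) ξ k) :
    ∃ᶠ ε in 𝓝[>] (0 : ℝ), u ε 1 0 ≤ -(1 / 2) + η := by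
  have h16 : 0 < 16 / η := by positivity
  have hsmall : ∀ᶠ ε in 𝓝[>] (0 : ℝ), ε ≤ η ^ 2 / 1000 :=
    eventually_nhdsWithin_of_eventually_nhds (eventually_le_nhds (by positivity))
  refine tendsto_two_pow_inv_pnat.frequently
    ((hstrip.and_eventually (tendsto_two_pow_inv_pnat.eventually hsmall)).mono ?_)
  rintro k ⟨hk, hε'⟩
  have hε : 0 < ((2 : ℝ) ^ (k : ℕ))⁻¹ := inv_pos.2 (by positivity)
  have hs := hu _ hε
  obtain ⟨l, m, hl, hm, hlm⟩ := hk.exists_weight_le (h16.le.trans hlam) (h16.le.trans hmu)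
  refine (hs.separableSubsolution hh).le_of_box (l := l) (m := m) (by decide) hη hη' hlam hmu hθ hε
    hε' hs.continuousOn hs.bounded hs.initial
    (fun y => (abs_le.1 (abs_weight_le lam mu ξ _)).2) ?_ ?_ ?_
  all_goals rw [inv_inv]
  exacts [hl, hm, fun y => hlm _]

theorem IsSolutionFamily.frequently_ge (hη : 0 < η) (hη' : η < 1 / 2)
    (hlam : 16 / η ≤ lam) (hmu : 16 / η ≤ mu) (hθ : ∀ i, |θ i| ≤ 1)
    (hh : ∀ p : Plane, |p 0| ≤ 2 → |p 1| ≤ 2 → h p = |p 1| - |p 0|)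
    (hu : IsSolutionFamily h (fun y => weight lam mu ξ (y + θ)) u)
    (hstrip : ∃ᶠ k in atTop, HasStrip (η / 100) (η / 100 + lam + mu + 1) (ξ ∘ siteSwap) k) :
    ∃ᶠ ε in 𝓝[>] (0 : ℝ), 1 / 2 - η ≤ u ε 1 0 := by
  have h16 : 0 < 16 / η := by positivity
  have hsmall : ∀ᶠ ε in 𝓝[>] (0 : ℝ), ε ≤ η ^ 2 / 1000 :=
    eventually_nhdsWithin_of_eventually_nhds (eventually_le_nhds (by positivity))
  refine tendsto_two_pow_inv_pnat.frequently
    ((hstrip.and_eventually (tendsto_two_pow_inv_pnat.eventually hsmall)).mono ?_)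
  rintro k ⟨hk, hε'⟩
  have hε : 0 < ((2 : ℝ) ^ (k : ℕ))⁻¹ := inv_pos.2 (by positivity)
  have hs := hu _ hε
  obtain ⟨l, m, hl, hm, hlm⟩ := hk.exists_le_weight (h16.le.trans hlam) (h16.le.trans hmu)
  have := (hs.separableSubsolution_neg hh).le_of_box (l := l) (m := m) (by decide) hη hη' hlam hmu
    hθ hε hε' hs.continuousOn.neg (by simpa using hs.bounded) (by simpa using hs.initial)
    (fun y => by linarith [(abs_le.1 (abs_weight_le lam mu ξ (y + θ))).1])
    (by rwa [inv_inv]) (by rwa [inv_inv]) ?_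
  · linarith
  · rw [inv_inv]
    exact fun y h1 h2 => neg_le_neg (hlm _ h1 h2)

theorem not_tendsto_of_frequently {f : ℝ → ℝ} {a b : ℝ} (hab : a < b)
    (h1 : ∃ᶠ ε in 𝓝[>] (0 : ℝ), f ε ≤ a) (h2 : ∃ᶠ ε in 𝓝[>] (0 : ℝ), b ≤ f ε) :
    ¬ ∃ l : ℝ, Tendsto f (𝓝[>] (0 : ℝ)) (𝓝 l) := by
  rintro ⟨l, hl⟩
  have h3 : l ≤ a := by
    by_contra! hlt
    exact h1 ((hl.eventually_const_lt hlt).mono fun _ => not_le.2)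
  have h4 : b ≤ l := by
    by_contra! hlt
    exact h2 ((hl.eventually_lt_const hlt).mono fun _ => not_le.2)
  linarith

end strip

/-! ### The law of the Bernoulli family -/

/-- The parameter `T_k ^ (-2)` of the Bernoulli variable at a site of level `k`. -/
noncomputable def siteProb (k : ℕ+) : ℝ := ((2 : ℝ) ^ (k : ℕ))⁻¹ ^ 2

theorem siteProb_pos (k : ℕ+) : 0 < siteProb k := by
  unfold siteProb
  positivity

theorem siteProb_le (k : ℕ+) : siteProb k ≤ 1 / 4 := by
  have h := inv_anti₀ two_pos (two_le_two_pow k)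
  calc siteProb k ≤ (2 : ℝ)⁻¹ ^ 2 := pow_le_pow_left₀ (by positivity) h 2
    _ = 1 / 4 := by norm_num

/-- The Bernoulli law at a site. -/
noncomputable def siteLaw (i : Site) : Measure Bool :=
  ENNReal.ofReal (siteProb i.2.1) • Measure.dirac true +
    ENNReal.ofReal (1 - siteProb i.2.1) • Measure.dirac false

instance isProbabilityMeasure_siteLaw (i : Site) : IsProbabilityMeasure (siteLaw i) := by
  constructor
  have h1 := siteProb_pos i.2.1
  have h2 := siteProb_le i.2.1
  simp only [siteLaw, Measure.add_apply, Measure.smul_apply, measure_univ, smul_eq_mul, mul_one]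
  rw [← ENNReal.ofReal_add h1.le (by linarith), add_sub_cancel, ENNReal.ofReal_one]

theorem siteLaw_singleton_true (i : Site) :
    siteLaw i {true} = ENNReal.ofReal (siteProb i.2.1) := by
  simp [siteLaw]

theorem siteLaw_singleton_false (i : Site) :
    siteLaw i {false} = ENNReal.ofReal (1 - siteProb i.2.1) := by
  simp [siteLaw]

theorem eq_of_apply_singleton_true {μ ν : Measure Bool} [IsProbabilityMeasure μ]
    [IsProbabilityMeasure ν] (h : μ {true} = ν {true}) : μ = ν := by
  refine Measure.ext_of_singleton fun b => ?_
  cases b with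
  | true => exact h
  | false =>
    have e : ({false} : Set Bool) = {true}ᶜ := by ext b; cases b <;> simp
    rw [e, prob_compl_eq_one_sub (measurableSet_singleton _),
      prob_compl_eq_one_sub (measurableSet_singleton _), h]

/-- The law of the whole Bernoulli family. -/
noncomputable def familyLaw : Measure (Site → Bool) := Measure.infinitePi siteLaw

instance : IsProbabilityMeasure familyLaw := by
  unfold familyLaw
  infer_instance

/-- Independence and the marginals determine the joint law, so all almost sure statements can be
proved on the canonical space `Site → Bool`. -/
theorem IsBernoulliFamily.measurePreserving {Ω : Type*} [MeasurableSpace Ω] {P : Measure Ω}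
    [IsProbabilityMeasure P] {X : Site → Ω → Bool} (hX : IsBernoulliFamily P X) :
    MeasurePreserving (fun ω i => X i ω) P familyLaw := by
  refine ⟨measurable_pi_iff.2 hX.measurable, ?_⟩
  rw [hX.indep.map_fun_eq_infinitePi_map hX.measurable, familyLaw]
  congr 1
  funext i
  have := Measure.isProbabilityMeasure_map (μ := P) (hX.measurable i).aemeasurable
  refine eq_of_apply_singleton_true ?_
  rw [Measure.map_apply (hX.measurable i) (measurableSet_singleton _), siteLaw_singleton_true]
  exact hX.law i.1 i.2.1 i.2.2.1 i.2.2.2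

theorem iIndepFun_familyLaw : iIndepFun (fun (i : Site) (ξ : Site → Bool) => ξ i) familyLaw :=
  iIndepFun_infinitePi (X := fun _ b => b) fun _ => measurable_id

theorem familyLaw_apply (i : Site) (s : Set Bool) :
    familyLaw {ξ | ξ i ∈ s} = siteLaw i s := by
  rw [← (measurePreserving_eval_infinitePi siteLaw i).measure_preimage
    (MeasurableSet.of_discrete (s := s)).nullMeasurableSet]
  rfl

/-- The parameter depends on the level only, so an injective relabelling that keeps levels preserves
the law. This covers both lattice translations and the exchange of the coordinates. -/
theorem isBernoulliFamily_comp {σ : Site → Site} (hσ : Function.Injective σ)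
    (hlevel : ∀ i, (σ i).2.1 = i.2.1) :
    IsBernoulliFamily familyLaw fun i (ξ : Site → Bool) => ξ (σ i) where
  measurable i := measurable_pi_apply _
  indep := iIndepFun_familyLaw.precomp hσ
  law j k l m := by
    have := familyLaw_apply (σ (j, k, l, m)) {true}
    rw [siteLaw_singleton_true, hlevel] at this
    exact this

theorem measurePreserving_comp {σ : Site → Site} (hσ : Function.Injective σ)
    (hlevel : ∀ i, (σ i).2.1 = i.2.1) :
    MeasurePreserving (fun ξ : Site → Bool => ξ ∘ σ) familyLaw familyLaw :=
  (isBernoulliFamily_comp hσ hlevel).measurePreserving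

theorem siteSwap_involutive : Function.Involutive siteSwap := by
  rintro ⟨j, k, l, m⟩
  simp [siteSwap]

theorem measurePreserving_siteSwap :
    MeasurePreserving (fun ξ : Site → Bool => ξ ∘ siteSwap) familyLaw familyLaw :=
  measurePreserving_comp siteSwap_involutive.injective fun _ => rfl

/-- The translation of sites. -/
def siteShift (n : ℤ × ℤ) (i : Site) : Site := (i.1, i.2.1, i.2.2.1 + n.1, i.2.2.2 + n.2)

theorem siteShift_injective (n : ℤ × ℤ) : Function.Injective (siteShift n) := by
  rintro ⟨j, k, l, m⟩ ⟨j', k', l', m'⟩ h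
  simpa [siteShift] using h

theorem measurePreserving_shift (n : ℤ × ℤ) :
    MeasurePreserving (shift n) familyLaw familyLaw :=
  measurePreserving_comp (siteShift_injective n) fun _ => rfl

theorem indep_cylinderEvents {S T : Set Site} (hST : Disjoint S T) :
    Indep (cylinderEvents (X := fun _ : Site => Bool) S) (cylinderEvents T) familyLaw :=
  indep_iSup_of_disjoint (fun i => (measurable_pi_apply i).comap_le) iIndepFun_familyLaw.iIndep hST

/-! ### Ergodicity of the lattice translations -/

theorem exists_disjoint_image_siteShift (s : Finset Site) :
    ∃ n, Disjoint (s : Set Site) (siteShift n '' s) := by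
  obtain ⟨M, hM⟩ : ∃ M : ℤ, ∀ i ∈ s, |i.2.2.1| ≤ M := by
    obtain ⟨M, hM⟩ := (s.image fun i => |i.2.2.1|).bddAbove
    exact ⟨M, fun i hi => hM (Finset.mem_coe.2 (Finset.mem_image_of_mem _ hi))⟩
  refine ⟨(2 * M + 1, 0), Set.disjoint_left.2 ?_⟩
  rintro _ hi ⟨i, hi', rfl⟩
  have h1 := abs_le.1 (hM _ hi)
  have h2 := abs_le.1 (hM _ hi')
  simp only [siteShift] at h1
  omega

theorem measurable_shift_cylinderEvents (n : ℤ × ℤ) (S : Set Site) :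
    Measurable[cylinderEvents (X := fun _ : Site => Bool) (siteShift n '' S), cylinderEvents S]
      (shift n) :=
  measurable_cylinderEvents_iff.2 fun i hi =>
    measurable_cylinderEvent_apply (X := fun _ : Site => Bool) (i := siteShift n i)
      (Set.mem_image_of_mem _ hi)

theorem MeasurableSet.cylinder_cylinderEvents (s : Finset Site) {S : Set (∀ _ : s, Bool)}
    (hS : MeasurableSet S) :
    MeasurableSet[cylinderEvents (X := fun _ : Site => Bool) (s : Set Site)] (cylinder s S) :=
  (measurable_restrict_cylinderEvents (s : Set Site)) hS

/-- An invariant `B` is close to a cylinder `C`, hence also to a far translate of `C`, which is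
independent of `C`. Thus `B` is approximately independent of itself, and `p = p * p` in the limit.
-/
theorem measure_eq_zero_or_one_of_shift_invariant {B : Set (Site → Bool)} (hB : MeasurableSet B)
    (hinv : ∀ n, shift n ⁻¹' B =ᵐ[familyLaw] B) : familyLaw B = 0 ∨ familyLaw B = 1 := by
  set p := familyLaw.real B with hp
  have hp0 : 0 ≤ p := measureReal_nonneg
  have hp1 : p ≤ 1 := measureReal_le_one
  -- With `q` the measure of `C`: `|q - p| ≤ δ` and `|q * q - p| ≤ 2 * δ`, and `|q * q - p * p| ≤ 2
  -- * δ`, which gives the factor 4.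
  have key : ∀ δ : ℝ, 0 < δ → |p - p * p| ≤ 4 * δ := by
    intro δ hδ
    obtain ⟨C, hC, hCB⟩ := exists_measure_symmDiff_lt_of_generateFrom_isSetRing (μ := familyLaw)
      (isSetRing_measurableCylinders (α := fun _ : Site => Bool))
      ⟨{Set.univ}, Set.countable_singleton _, 
        Set.singleton_subset_iff.2 (univ_mem_measurableCylinders _), by simp⟩
      generateFrom_measurableCylinders.symm hB (ENNReal.ofReal_pos.2 hδ)
    obtain ⟨s, S, hS, rfl⟩ := (mem_measurableCylinders _).1 hC
    set C := cylinder (α := fun _ : Site => Bool) s S with hCdef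
    have hCm : MeasurableSet C := hS.cylinder s
    have hCB' : familyLaw.real (symmDiff C B) ≤ δ :=
      ENNReal.toReal_le_of_le_ofReal hδ.le hCB.le
    obtain ⟨n, hn⟩ := exists_disjoint_image_siteShift s
    have hmp := measurePreserving_shift n
    set C' := shift n ⁻¹' C with hC'
    have hC'm : MeasurableSet C' := hmp.measurable hCm
    have hind : familyLaw.real (C ∩ C') = familyLaw.real C * familyLaw.real C := by
      have h1 := (Indep_iff _ _ _).1 (indep_cylinderEvents hn) _ _
        (MeasurableSet.cylinder_cylinderEvents s hS)
        (measurable_shift_cylinderEvents n _ (MeasurableSet.cylinder_cylinderEvents s hS))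
      rw [measureReal_def, h1, ENNReal.toReal_mul, hmp.measure_preimage hCm.nullMeasurableSet]
      rfl
    have hC'B : familyLaw.real (symmDiff C' B) ≤ δ := by
      have h1 : familyLaw (symmDiff C' B) = familyLaw (symmDiff C' (shift n ⁻¹' B)) :=
        measure_congr ((ae_eq_refl C').symmDiff (hinv n).symm)
      have h2 : symmDiff C' (shift n ⁻¹' B) = shift n ⁻¹' (symmDiff C B) := rfl
      rw [h2, hmp.measure_preimage (hCm.symmDiff hB).nullMeasurableSet] at h1
      rwa [measureReal_def, h1]
    have h1 := abs_measureReal_sub_le_measureReal_symmDiff (μ := familyLaw)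
      hCm.nullMeasurableSet hB.nullMeasurableSet
    have h2 := abs_measureReal_sub_le_measureReal_symmDiff (μ := familyLaw)
      (hCm.inter hC'm).nullMeasurableSet hB.nullMeasurableSet
    have h3 : familyLaw.real (symmDiff (C ∩ C') B) ≤ δ + δ := by
      refine le_trans (measureReal_mono ?_ (measure_ne_top _ _))
        ((measureReal_union_le (symmDiff C B) (symmDiff C' B)).trans (add_le_add hCB' hC'B))
      intro ξ hξ
      simp only [Set.mem_symmDiff, Set.mem_inter_iff, Set.mem_union] at hξ ⊢
      tauto
    rw [hind] at h2
    have hq0 : 0 ≤ familyLaw.real C := measureReal_nonneg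
    have hq1 : familyLaw.real C ≤ 1 := measureReal_le_one
    rw [← hp] at h1 h2
    have h4 := abs_le.1 (h1.trans hCB')
    have h5 := abs_le.1 (h2.trans h3)
    rw [abs_le]
    constructor <;> nlinarith
  have h0 : p - p * p = 0 := by
    refine abs_nonpos_iff.1 (le_of_forall_pos_le_add fun δ hδ => ?_)
    have := key (δ / 4) (by positivity)
    linarith
  have h1 : p * (1 - p) = 0 := by linarith
  rcases mul_eq_zero.1 h1 with h | h
  · left
    rwa [hp, measureReal_eq_zero_iff] at h
  · right
    have : familyLaw.real B = 1 := by linarith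
    rw [measureReal_def] at this
    rwa [ENNReal.toReal_eq_one_iff] at this

/-! ### Counting sites -/

/-- The integers of absolute value at most `R`. -/
noncomputable def intBox (R : ℝ) : Finset ℤ := Finset.Icc (-⌊R⌋) ⌊R⌋

theorem mem_intBox {R : ℝ} {l : ℤ} : l ∈ intBox R ↔ |(l : ℝ)| ≤ R := by
  rw [intBox, Finset.mem_Icc, abs_le, Int.le_floor, neg_le, Int.le_floor, Int.cast_neg, neg_le]

theorem card_intBox {R : ℝ} (hR : 0 ≤ R) : ((intBox R).card : ℝ) = 2 * ⌊R⌋ + 1 := by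
  have h : 0 ≤ ⌊R⌋ := Int.floor_nonneg.2 hR
  have h1 : ((intBox R).card : ℤ) = 2 * ⌊R⌋ + 1 := by
    rw [intBox, Int.card_Icc]
    omega
  exact_mod_cast h1

theorem card_intBox_le {R : ℝ} (hR : 1 ≤ R) : ((intBox R).card : ℝ) ≤ 3 * R := by
  rw [card_intBox (by linarith)]
  linarith [Int.floor_le R]

theorem le_card_intBox {R : ℝ} (hR : 0 ≤ R) : R ≤ (intBox R).card := by
  rw [card_intBox hR]
  have h : (0 : ℝ) ≤ ⌊R⌋ := by exact_mod_cast Int.floor_nonneg.2 hR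
  linarith [Int.lt_floor_add_one R]

/-- The sites of orientation `j` with a centre in `D k`, where `k` is the level. -/
def sitesOf (j : Fin 2) (D : ℕ+ → Finset (ℤ × ℤ)) : Set Site :=
  {i | i.1 = j ∧ i.2.2 ∈ D i.2.1}

open Classical in
theorem tsum_sitesOf (j : Fin 2) (D : ℕ+ → Finset (ℤ × ℤ)) :
    ∑' i : Site, (if i ∈ sitesOf j D then ENNReal.ofReal (siteProb i.2.1) else 0) =
      ∑' k, ((D k).card : ENNReal) * ENNReal.ofReal (siteProb k) := by
  have h1 : ∀ k : ℕ+, ∑' n : ℤ × ℤ, (if n ∈ D k then ENNReal.ofReal (siteProb k) else 0) =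
      ((D k).card : ENNReal) * ENNReal.ofReal (siteProb k) := by
    intro k
    rw [tsum_eq_sum (s := D k) fun n hn => if_neg hn, Finset.sum_ite_mem, Finset.inter_self,
      Finset.sum_const, nsmul_eq_mul]
  have h2 : ∀ j' : Fin 2, j' ≠ j → ∑' a : ℕ+ × ℤ × ℤ,
      (if (j', a) ∈ sitesOf j D then ENNReal.ofReal (siteProb a.1) else 0) = 0 := by
    intro j' hj'
    refine ENNReal.tsum_eq_zero.2 fun a => if_neg fun h => hj' h.1
  rw [ENNReal.tsum_prod (f := fun (j' : Fin 2) (a : ℕ+ × ℤ × ℤ) =>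
    if (j', a) ∈ sitesOf j D then ENNReal.ofReal (siteProb a.1) else 0), tsum_eq_single j h2,
    ENNReal.tsum_prod (f := fun (k : ℕ+) (n : ℤ × ℤ) =>
      if (j, k, n) ∈ sitesOf j D then ENNReal.ofReal (siteProb k) else 0)]
  refine tsum_congr fun k => (tsum_congr fun n => ?_).trans (h1 k)
  simp [sitesOf]

theorem tsum_ofReal_geometric (C : ℝ) (hC : 0 ≤ C) :
    ∑' n : ℕ, ENNReal.ofReal (C * (1 / 2) ^ n) = ENNReal.ofReal (2 * C) := by
  rw [← ENNReal.ofReal_tsum_of_nonneg (fun n => by positivity)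
    (summable_geometric_two.mul_left C), tsum_mul_left, tsum_geometric_two, mul_comm]

theorem tsum_pnat_le {a : ℕ+ → ENNReal} {C : ℝ} (hC : 0 ≤ C) (k₀ : ℕ+)
    (h0 : ∀ k < k₀, a k = 0)
    (ha : ∀ k, k₀ ≤ k → a k ≤ ENNReal.ofReal (C * (2 ^ (k₀ : ℕ) * ((2 : ℝ) ^ (k : ℕ))⁻¹))) :
    ∑' k, a k ≤ ENNReal.ofReal (2 * C) := by
  set f : ℕ → ℕ+ := fun n => ⟨k₀ + n, by positivity⟩ with hf
  have hinj : Function.Injective f := fun n n' h => by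
    have := congrArg PNat.val h
    simpa [hf] using this
  have hsupp : Function.support a ⊆ Set.range f := by
    intro k hk
    have hle : k₀ ≤ k := not_lt.1 fun h => hk (h0 k h)
    refine ⟨(k : ℕ) - k₀, PNat.eq ?_⟩
    have : (k₀ : ℕ) ≤ k := hle
    simp only [hf, PNat.mk_coe]
    omega
  rw [← hinj.tsum_eq hsupp, ← tsum_ofReal_geometric C hC]
  refine ENNReal.tsum_le_tsum fun n => (ha (f n) ?_).trans_eq ?_
  · exact PNat.coe_le_coe _ _ |>.1 (by simp [hf])
  · congr 2
    simp only [hf, PNat.mk_coe, pow_add, mul_inv, one_div, inv_pow]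
    field_simp

theorem ofReal_card_mul_siteProb {s : Finset (ℤ × ℤ)} (k : ℕ+) :
    (s.card : ENNReal) * ENNReal.ofReal (siteProb k) = ENNReal.ofReal (s.card * siteProb k) := by
  rw [ENNReal.ofReal_mul (by positivity), ENNReal.ofReal_natCast]

theorem card_product_mul_siteProb_le {A B : ℝ} (hA : 1 ≤ A) (hB : 1 ≤ B) (k : ℕ+) :
    ((intBox A ×ˢ intBox B).card : ℝ) * siteProb k ≤ 9 * (A * B) * siteProb k := by
  refine mul_le_mul_of_nonneg_right ?_ (siteProb_pos k).le
  rw [Finset.card_product, Nat.cast_mul]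
  calc _ ≤ (3 * A) * (3 * B) :=
        mul_le_mul (card_intBox_le hA) (card_intBox_le hB) (by positivity) (by positivity)
    _ = _ := by ring

/-- Level `k` has of order `A * 2 ^ k₀ * B * 2 ^ k` sites of probability `2 ^ (-2 * k)`: the mean
number of selected sites decays like `2 ^ (k₀ - k)`, with a sum independent of `k₀`. -/
theorem tsum_card_le {A B : ℝ} (hA : 1 ≤ A) (hB : 1 ≤ B) (k₀ : ℕ+) {D : ℕ+ → Finset (ℤ × ℤ)}
    (h0 : ∀ k < k₀, D k = ∅)
    (hD : ∀ k, k₀ ≤ k → D k = intBox (A * 2 ^ (k₀ : ℕ)) ×ˢ intBox (B * 2 ^ (k : ℕ))) :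
    ∑' k, ((D k).card : ENNReal) * ENNReal.ofReal (siteProb k) ≤
      ENNReal.ofReal (2 * (9 * (A * B))) := by
  refine tsum_pnat_le (by positivity) k₀ (fun k hk => by simp [h0 k hk]) fun k hk => ?_
  rw [ofReal_card_mul_siteProb, hD k hk]
  refine ENNReal.ofReal_le_ofReal ((card_product_mul_siteProb_le ?_ ?_ k).trans_eq ?_)
  · exact one_le_mul_of_one_le_of_one_le hA (by linarith [two_le_two_pow k₀])
  · exact one_le_mul_of_one_le_of_one_le hB (by linarith [two_le_two_pow k])
  · unfold siteProb
    field_simp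

/-! ### Local finiteness and measurability of the environment -/

/-- The sites of level `k` at distance of order `N * 2 ^ k` and `N` from the origin, in the
directions along and across the rectangle. -/
def NearOrigin (N : ℕ) (i : Site) : Prop :=
  |(i.2.2.1 : ℝ)| ≤ N * 2 ^ (i.2.1 : ℕ) ∧ |(i.2.2.2 : ℝ)| ≤ N

/-- Only finitely many selected rectangles meet any given ball. -/
def IsLocallyFinite (ξ : Site → Bool) : Prop :=
  ∀ N : ℕ, {i | i.1 = 0 ∧ NearOrigin N i ∧ ξ i = true}.Finite ∧
    {i | i.1 = 0 ∧ NearOrigin N i ∧ ξ (siteSwap i) = true}.Finite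

/-- Borel-Cantelli: of order `N ^ 2 * 2 ^ k` sites of level `k` are near the origin, each of
probability `2 ^ (-2 * k)`. -/
theorem ae_finite_nearOrigin (N : ℕ) :
    ∀ᵐ ξ ∂familyLaw, {i : Site | i.1 = 0 ∧ NearOrigin N i ∧ ξ i = true}.Finite := by
  classical
  wlog hN : 1 ≤ N generalizing N
  · filter_upwards [this 1 le_rfl] with ξ hξ
    refine hξ.subset fun i hi => ⟨hi.1, ?_, hi.2.2⟩
    have hN0 : N = 0 := by omega
    subst hN0
    obtain ⟨h1, h2⟩ := hi.2.1
    rw [Nat.cast_zero, zero_mul] at h1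
    rw [Nat.cast_zero] at h2
    refine ⟨h1.trans (by positivity), h2.trans (by positivity)⟩
  have hN1 : (1 : ℝ) ≤ N := by exact_mod_cast hN
  set D : ℕ+ → Finset (ℤ × ℤ) := fun k => intBox (N * 2 ^ (k : ℕ)) ×ˢ intBox N with hD
  have hsum : ∑' k, ((D k).card : ENNReal) * ENNReal.ofReal (siteProb k) ≤
      ENNReal.ofReal (2 * (9 * (N * N : ℝ))) := by
    refine tsum_pnat_le (by positivity) 1 (fun k hk => absurd hk not_lt_one) fun k _ => ?_
    rw [ofReal_card_mul_siteProb]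
    have h2 := two_le_two_pow k
    refine ENNReal.ofReal_le_ofReal ((card_product_mul_siteProb_le ?_ hN1 k).trans ?_)
    · exact one_le_mul_of_one_le_of_one_le hN1 (by linarith)
    · have e : 9 * ((N : ℝ) * 2 ^ (k : ℕ) * N) * siteProb k =
          9 * (N * N : ℝ) * (1 * ((2 : ℝ) ^ (k : ℕ))⁻¹) := by
        unfold siteProb
        field_simp
      rw [e]
      gcongr
      norm_num
  have hfin := ae_finite_setOfPred_mem (μ := familyLaw)
    (s := fun i : Site => {ξ | i ∈ sitesOf 0 D ∧ ξ i = true}) ?_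
  · filter_upwards [hfin] with ξ hξ
    refine hξ.subset fun i hi => ⟨⟨hi.1, ?_⟩, hi.2.2⟩
    exact Finset.mem_product.2 ⟨mem_intBox.2 hi.2.1.1, mem_intBox.2 hi.2.1.2⟩
  · refine ne_top_of_le_ne_top ENNReal.ofReal_ne_top (le_trans ?_ hsum)
    rw [← tsum_sitesOf 0]
    refine ENNReal.tsum_le_tsum fun i => ?_
    split_ifs with h
    · refine le_of_eq ?_
      rw [← siteLaw_singleton_true, ← familyLaw_apply]
      congr 1
      ext ξ
      simp [h]
    · simp [h]

theorem ae_isLocallyFinite : ∀ᵐ ξ ∂familyLaw, IsLocallyFinite ξ :=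
  ae_all_iff.2 fun N => (ae_finite_nearOrigin N).and
    (measurePreserving_siteSwap.quasiMeasurePreserving.ae (ae_finite_nearOrigin N))

open Classical in
/-- The configuration obtained by discarding the sites outside a finite set. -/
noncomputable def truncate (s : Finset Site) (ξ : Site → Bool) : Site → Bool :=
  fun i => if i ∈ s then ξ i else false

theorem measurable_weight_truncate (lam mu : ℝ) (s : Finset Site) (x : Plane) :
    Measurable fun ξ => weight lam mu (truncate s ξ) x := by
  classical
  have h : (fun ξ => weight lam mu (truncate s ξ) x) =
      (fun ζ : s → Bool => weight lam mu (fun i => if h : i ∈ s then ζ ⟨i, h⟩ else false) x) ∘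
        s.restrict := by
    funext ξ
    simp only [Function.comp_apply]
    congr 1
  rw [h]
  exact (measurable_of_countable _).comp (measurable_pi_iff.2 fun i => measurable_pi_apply _)

/-- The value at `x` depends only on rectangles meeting the unit ball around `x`. Their centres
satisfy `NearOrigin N`, up to `siteSwap` for vertical ones, so finitely many are selected. -/
theorem IsLocallyFinite.eventually_weight_truncate {lam mu : ℝ} (hlam : 0 ≤ lam) (hmu : 0 ≤ mu)
    {ξ : Site → Bool} (hξ : IsLocallyFinite ξ) (x : Plane) :
    ∀ᶠ s : Finset Site in atTop, weight lam mu (truncate s ξ) x = weight lam mu ξ x := by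
  obtain ⟨N, hN⟩ := exists_nat_ge (|x 0| + |x 1| + lam + mu + 3)
  have hnear : ∀ (i j : Fin 2) (k : ℕ+) (l m : ℤ) (y : Plane), i ≠ j → dist x y < 1 →
      |y i - l| ≤ (lam * 2 ^ (k : ℕ) + 1) / 2 → |y j - m| ≤ (mu + 1) / 2 →
      |(l : ℝ)| ≤ N * 2 ^ (k : ℕ) ∧ |(m : ℝ)| ≤ N := by
    intro i j k l m y hij hy hi hj
    have h1 := abs_coord_sub_le x y i
    have h2 := abs_coord_sub_le x y j
    have h0 : |x i| ≤ |x 0| + |x 1| := by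
      fin_cases i
      exacts [le_add_of_nonneg_right (abs_nonneg _), le_add_of_nonneg_left (abs_nonneg _)]
    have h0' : |x j| ≤ |x 0| + |x 1| := by
      fin_cases j
      exacts [le_add_of_nonneg_right (abs_nonneg _), le_add_of_nonneg_left (abs_nonneg _)]
    have hT := two_le_two_pow k
    have e1 : (|x 0| + |x 1| + lam + mu + 3) * 2 ^ (k : ℕ) ≤ N * 2 ^ (k : ℕ) :=
      mul_le_mul_of_nonneg_right hN (by positivity)
    have e2 : (|x 0| + |x 1| + mu + 3) * 1 ≤ (|x 0| + |x 1| + mu + 3) * 2 ^ (k : ℕ) :=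
      mul_le_mul_of_nonneg_left (by linarith) (by positivity)
    have e3 : 0 ≤ lam * 2 ^ (k : ℕ) := by positivity
    rw [abs_le] at h0 h0' h1 h2 hi hj
    constructor <;> rw [abs_le] <;> constructor <;> linarith
  filter_upwards [eventually_ge_atTop (hξ N).1.toFinset,
    eventually_ge_atTop ((hξ N).2.image siteSwap).toFinset] with s hs hs'
  have hsub : ∀ i, truncate s ξ i = true → ξ i = true := by
    intro i hi
    unfold truncate at hi
    split_ifs at hi
    exact hi
  have hmem : ∀ i ∈ s, truncate s ξ i = ξ i := fun i hi => if_pos hi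
  refine weight_congr (fun k y hy => ⟨?_, ?_⟩) fun k y hy => ⟨?_, ?_⟩
  · rintro ⟨l, m, h, h0, h1⟩
    exact ⟨l, m, hsub _ h, h0, h1⟩
  · rintro ⟨l, m, h, h0, h1⟩
    refine ⟨l, m, ?_, h0, h1⟩
    rw [hmem _ (hs ?_), h]
    rw [Set.Finite.mem_toFinset]
    exact ⟨rfl, hnear 0 1 k l m y (by decide) hy h0 h1, h⟩
  · rintro ⟨l, m, h, h0, h1⟩
    exact ⟨l, m, hsub _ h, h0, h1⟩
  · rintro ⟨l, m, h, h0, h1⟩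
    refine ⟨l, m, ?_, h0, h1⟩
    rw [hmem _ (hs' ?_), h]
    rw [Set.Finite.mem_toFinset]
    exact ⟨(0, k, m, l), ⟨rfl, hnear 1 0 k m l y (by decide) hy h1 h0, h⟩, rfl⟩

/-- A version of the environment which is measurable in `ξ` and Lipschitz in `x`. -/
theorem exists_measurable_weight {lam mu : ℝ} (hlam : 0 ≤ lam) (hmu : 0 ≤ mu) :
    ∃ W : (Site → Bool) → Plane → ℝ, Measurable W ∧ (∀ ξ, Continuous (W ξ)) ∧
      weight lam mu =ᵐ[familyLaw] W := by
  classical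
  -- Local finiteness is only known outside a null set; a measurable null superset is removed and
  -- the field is set to 0 there. On `G` the field is the limit of truncations depending on finitely
  -- many bits.
  set G : Set (Site → Bool) := (toMeasurable familyLaw {ξ | ¬ IsLocallyFinite ξ})ᶜ with hG
  have hGm : MeasurableSet G := (measurableSet_toMeasurable _ _).compl
  have hGf : ∀ ξ ∈ G, IsLocallyFinite ξ := by
    intro ξ hξ
    by_contra h
    exact hξ (subset_toMeasurable _ _ h)
  have hG1 : ∀ᵐ ξ ∂familyLaw, ξ ∈ G := by
    rw [ae_iff]
    simp only [hG, Set.mem_compl_iff, not_not]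
    change familyLaw (toMeasurable familyLaw {ξ | ¬ IsLocallyFinite ξ}) = 0
    rw [measure_toMeasurable]
    exact ae_isLocallyFinite
  refine ⟨G.indicator (weight lam mu), ?_, ?_, ?_⟩
  · refine measurable_pi_iff.2 fun x => ?_
    have h1 : ∀ s, Measurable (G.indicator fun ξ => weight lam mu (truncate s ξ) x) :=
      fun s => (measurable_weight_truncate lam mu s x).indicator hGm
    refine measurable_of_tendsto_metrizable' atTop h1 (tendsto_pi_nhds.2 fun ξ => ?_)
    refine tendsto_const_nhds.congr' ?_
    by_cases hξ : ξ ∈ G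
    · filter_upwards [(hGf ξ hξ).eventually_weight_truncate hlam hmu x] with s hs
      simp [hξ, hs]
    · exact Eventually.of_forall fun s => by simp [hξ]
  · intro ξ
    by_cases hξ : ξ ∈ G
    · rw [Set.indicator_of_mem hξ]
      exact (lipschitzWith_weight lam mu ξ).continuous
    · rw [Set.indicator_of_notMem hξ]
      exact continuous_const
  · filter_upwards [hG1] with ξ hξ
    rw [Set.indicator_of_mem hξ]

/-! ### Strips exist at infinitely many scales -/

theorem familyLaw_forall_eq_false (s : Finset Site) :
    familyLaw {ξ | ∀ i ∈ s, ξ i = false} =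
      ENNReal.ofReal (∏ i ∈ s, (1 - siteProb i.2.1)) := by
  have h := Measure.infinitePi_pi siteLaw (s := s) (t := fun _ => {false})
    fun _ _ => measurableSet_singleton _
  rw [ENNReal.ofReal_prod_of_nonneg fun i _ => by linarith [siteProb_le i.2.1]]
  simp only [siteLaw_singleton_false] at h
  rw [← h]
  rfl

/-- It follows from `exp (2 * p) ≥ 1 + 2 * p` and `(1 - p) * (1 + 2 * p) ≥ 1`. -/
theorem exp_le_one_sub {p : ℝ} (hp : 0 ≤ p) (hp' : p ≤ 1 / 4) : Real.exp (-(2 * p)) ≤ 1 - p := by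
  rw [Real.exp_neg, inv_le_iff_one_le_mul₀ (Real.exp_pos _)]
  have h1 := Real.add_one_le_exp (2 * p)
  nlinarith

open Classical in
-- `M` bounds the mean number of selected sites in `N`. Independence gives the bound for finite
-- subsets, and continuity from above passes it to the infinite set.
theorem exp_le_familyLaw_forall_eq_false {N : Set Site} {M : ℝ} (hM : 0 ≤ M)
    (hN : ∑' i : Site, (if i ∈ N then ENNReal.ofReal (siteProb i.2.1) else 0) ≤
      ENNReal.ofReal M) :
    ENNReal.ofReal (Real.exp (-(2 * M))) ≤ familyLaw {ξ | ∀ i ∈ N, ξ i = false} := by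
  set A : Finset Site → Set (Site → Bool) :=
    fun s => {ξ | ∀ i ∈ s.filter (· ∈ N), ξ i = false} with hA
  have hAm : ∀ s, MeasurableSet (A s) := fun s => by
    have : A s = ⋂ i ∈ s.filter (· ∈ N), {ξ : Site → Bool | ξ i = false} := by
      ext ξ
      simp [hA]
    rw [this]
    exact Finset.measurableSet_biInter _ fun i _ =>
      (measurableSet_singleton false).preimage (measurable_pi_apply i)
  have hanti : Antitone A := fun s t hst ξ hξ i hi =>
    hξ i (Finset.filter_subset_filter _ hst hi)
  have hInter : ⋂ s, A s = {ξ | ∀ i ∈ N, ξ i = false} := by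
    ext ξ
    simp only [hA, Set.mem_iInter, Set.mem_ofPred_eq, Finset.mem_filter]
    exact ⟨fun h i hi => h {i} i ⟨Finset.mem_singleton_self i, hi⟩, fun h s i hi => h i hi.2⟩
  have hlim := tendsto_measure_iInter_atTop (μ := familyLaw)
    (fun s => (hAm s).nullMeasurableSet) hanti ⟨∅, measure_ne_top _ _⟩
  rw [hInter] at hlim
  refine ge_of_tendsto hlim (Eventually.of_forall fun s => ?_)
  rw [Function.comp_apply, hA, familyLaw_forall_eq_false]
  refine ENNReal.ofReal_le_ofReal ?_
  have hsum : ∑ i ∈ s.filter (· ∈ N), siteProb i.2.1 ≤ M := by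
    rw [← ENNReal.ofReal_le_ofReal_iff hM,
      ENNReal.ofReal_sum_of_nonneg fun i _ => (siteProb_pos _).le, Finset.sum_filter]
    exact (ENNReal.sum_le_tsum s).trans hN
  calc Real.exp (-(2 * M)) ≤ Real.exp (∑ i ∈ s.filter (· ∈ N), -(2 * siteProb i.2.1)) := by
        rw [Finset.sum_neg_distrib, ← Finset.mul_sum]
        exact Real.exp_le_exp.2 (by linarith)
    _ = ∏ i ∈ s.filter (· ∈ N), Real.exp (-(2 * siteProb i.2.1)) := Real.exp_sum _ _
    _ ≤ _ := Finset.prod_le_prod (fun i _ => (Real.exp_pos _).le)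
        fun i _ => exp_le_one_sub (siteProb_pos _).le (siteProb_le _)

theorem familyLaw_forall_eq_false_le (s : Finset Site) :
    familyLaw {ξ | ∀ i ∈ s, ξ i = false} ≤
      ENNReal.ofReal (Real.exp (-∑ i ∈ s, siteProb i.2.1)) := by
  rw [familyLaw_forall_eq_false]
  refine ENNReal.ofReal_le_ofReal ?_
  rw [← Finset.sum_neg_distrib, Real.exp_sum]
  exact Finset.prod_le_prod (fun i _ => by linarith [siteProb_le i.2.1])
    fun i _ => by linarith [Real.add_one_le_exp (-siteProb i.2.1)]

variable {κ R : ℝ}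

theorem measurableSet_cylinderEvents_eq {S : Set Site} {i : Site} (hi : i ∈ S) (b : Bool) :
    MeasurableSet[cylinderEvents (X := fun _ : Site => Bool) S] {ξ | ξ i = b} :=
  measurable_cylinderEvent_apply (X := fun _ : Site => Bool) hi (measurableSet_singleton b)

theorem measurableSet_exists_seed (κ : ℝ) (k : ℕ+) {S : Set Site}
    (hS : ∀ l m, ((0, k, l, m) : Site) ∈ S) :
    MeasurableSet[cylinderEvents (X := fun _ : Site => Bool) S]
      {ξ | ∃ l m : ℤ, |(l : ℝ)| ≤ κ * 2 ^ (k : ℕ) ∧ |(m : ℝ)| ≤ κ * 2 ^ (k : ℕ) ∧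
        ξ (0, k, l, m) = true} := by
  simp only [Set.ofPred_exists, Set.ofPred_and]
  exact MeasurableSet.iUnion fun l => MeasurableSet.iUnion fun m =>
    (MeasurableSet.const _).inter ((MeasurableSet.const _).inter
      (measurableSet_cylinderEvents_eq (hS l m) true))

theorem measurableSet_forall_not_blocked (R : ℝ) (k : ℕ+) {S : Set Site}
    (hS : ∀ k' l m, k ≤ k' → ((1, k', l, m) : Site) ∈ S) :
    MeasurableSet[cylinderEvents (X := fun _ : Site => Bool) S]
      {ξ | ∀ (k' : ℕ+) (l m : ℤ), k ≤ k' → |(l : ℝ)| ≤ R * 2 ^ (k : ℕ) →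
        |(m : ℝ)| ≤ R * 2 ^ (k' : ℕ) → ξ (1, k', l, m) = false} := by
  simp only [Set.ofPred_forall]
  exact MeasurableSet.iInter fun k' => MeasurableSet.iInter fun l => MeasurableSet.iInter fun m =>
    MeasurableSet.iInter fun hk => MeasurableSet.iInter fun _ => MeasurableSet.iInter fun _ =>
      measurableSet_cylinderEvents_eq (hS k' l m hk) false

theorem measurableSet_hasStrip (κ R : ℝ) (k : ℕ+) {S : Set Site}
    (hS : ∀ j k' l m, k ≤ k' → ((j, k', l, m) : Site) ∈ S) :
    MeasurableSet[cylinderEvents (X := fun _ : Site => Bool) S] {ξ | HasStrip κ R ξ k} :=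
  (measurableSet_exists_seed κ k fun l m => hS 0 k l m le_rfl).inter
    (measurableSet_forall_not_blocked R k fun k' l m hk => hS 1 k' l m hk)

/-- The box has at least `(κ * 2 ^ k) ^ 2` sites of probability `2 ^ (-2 * k)`, so the mean number
of seeds is at least `κ ^ 2` at every level. -/
theorem le_familyLaw_exists_seed (hκ : 0 < κ) (k : ℕ+) :
    ENNReal.ofReal (1 - Real.exp (-κ ^ 2)) ≤
      familyLaw {ξ | ∃ l m : ℤ, |(l : ℝ)| ≤ κ * 2 ^ (k : ℕ) ∧ |(m : ℝ)| ≤ κ * 2 ^ (k : ℕ) ∧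
        ξ (0, k, l, m) = true} := by
  set f : ℤ × ℤ ↪ Site := ⟨fun n => (0, k, n), fun n n' h => by simpa using h⟩ with hf
  set s : Finset Site := (intBox (κ * 2 ^ (k : ℕ)) ×ˢ intBox (κ * 2 ^ (k : ℕ))).map f with hs
  have hset : {ξ : Site → Bool | ∃ l m : ℤ, |(l : ℝ)| ≤ κ * 2 ^ (k : ℕ) ∧
      |(m : ℝ)| ≤ κ * 2 ^ (k : ℕ) ∧ ξ (0, k, l, m) = true} = {ξ | ∀ i ∈ s, ξ i = false}ᶜ := by
    ext ξ
    simp only [hs, hf, Set.mem_ofPred_eq, Set.mem_compl_iff, Finset.mem_map, Finset.mem_product,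
      mem_intBox, not_forall, Bool.not_eq_false]
    constructor
    · rintro ⟨l, m, h1, h2, h3⟩
      exact ⟨_, ⟨(l, m), ⟨h1, h2⟩, rfl⟩, h3⟩
    · rintro ⟨_, ⟨⟨l, m⟩, ⟨h1, h2⟩, rfl⟩, h3⟩
      exact ⟨l, m, h1, h2, h3⟩
  have hm : MeasurableSet {ξ : Site → Bool | ∀ i ∈ s, ξ i = false} := by
    rw [← compl_compl {ξ : Site → Bool | ∀ i ∈ s, ξ i = false}, ← hset]
    have := measurableSet_exists_seed κ k (S := Set.univ) fun _ _ => trivial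
    rw [cylinderEvents_univ] at this
    exact this.compl
  have hsum : κ ^ 2 ≤ ∑ i ∈ s, siteProb i.2.1 := by
    rw [hs, Finset.sum_map]
    change _ ≤ ∑ _n ∈ _, siteProb k
    rw [Finset.sum_const, nsmul_eq_mul, Finset.card_product, Nat.cast_mul]
    have h0 : 0 ≤ κ * 2 ^ (k : ℕ) := by positivity
    have h1 := le_card_intBox h0
    calc κ ^ 2 = (κ * 2 ^ (k : ℕ)) * (κ * 2 ^ (k : ℕ)) * siteProb k := by
          unfold siteProb
          field_simp
      _ ≤ _ := mul_le_mul_of_nonneg_right (mul_le_mul h1 h1 h0 (h0.trans h1)) (siteProb_pos k).le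
  rw [hset, prob_compl_eq_one_sub hm, ENNReal.ofReal_sub _ (Real.exp_pos _).le,
    ENNReal.ofReal_one]
  refine tsub_le_tsub_left ((familyLaw_forall_eq_false_le s).trans ?_) 1
  exact ENNReal.ofReal_le_ofReal (Real.exp_le_exp.2 (neg_le_neg hsum))

theorem le_familyLaw_forall_not_blocked (hR : 1 ≤ R) (k : ℕ+) :
    ENNReal.ofReal (Real.exp (-(2 * (2 * (9 * (R * R)))))) ≤
      familyLaw {ξ | ∀ (k' : ℕ+) (l m : ℤ), k ≤ k' → |(l : ℝ)| ≤ R * 2 ^ (k : ℕ) →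
        |(m : ℝ)| ≤ R * 2 ^ (k' : ℕ) → ξ (1, k', l, m) = false} := by
  classical
  set D : ℕ+ → Finset (ℤ × ℤ) := fun k' =>
    if k ≤ k' then intBox (R * 2 ^ (k : ℕ)) ×ˢ intBox (R * 2 ^ (k' : ℕ)) else ∅ with hD
  refine (exp_le_familyLaw_forall_eq_false (N := sitesOf 1 D) (by positivity) ?_).trans
    (measure_mono ?_)
  · rw [tsum_sitesOf]
    exact tsum_card_le hR hR k (fun k' hk' => if_neg (not_le.2 hk')) fun k' hk' => if_pos hk'
  · intro ξ hξ k' l m hk' hl hm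
    refine hξ _ ⟨rfl, ?_⟩
    simp only [hD, if_pos hk', Finset.mem_product, mem_intBox]
    exact ⟨hl, hm⟩

/-- Seeds are horizontal and blocking sites vertical, so the two events are independent; the lower
bound does not depend on `k`. -/
theorem le_familyLaw_hasStrip (hκ : 0 < κ) (hR : 1 ≤ R) (k : ℕ+) :
    ENNReal.ofReal (1 - Real.exp (-κ ^ 2)) *
      ENNReal.ofReal (Real.exp (-(2 * (2 * (9 * (R * R)))))) ≤
        familyLaw {ξ | HasStrip κ R ξ k} := by
  have hd : Disjoint {i : Site | i.1 = 0} {i : Site | i.1 = 1} :=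
    Set.disjoint_left.2 fun i h0 h1 => by
      rw [Set.mem_ofPred_eq] at h0 h1
      rw [h0] at h1
      exact absurd h1 (by decide)
  have h := (Indep_iff _ _ _).1 (indep_cylinderEvents hd) _ _
    (measurableSet_exists_seed κ k fun _ _ => rfl)
    (measurableSet_forall_not_blocked R k fun _ _ _ _ => rfl)
  exact (mul_le_mul' (le_familyLaw_exists_seed hκ k)
    (le_familyLaw_forall_not_blocked hR k)).trans_eq h.symm

/-- By continuity from above the event has probability at least `c > 0`. A strip at level `k`
involves only sites of level at least `k`, so the event ignores any finite set of sites and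
Kolmogorov's zero-one law applies. -/
theorem ae_frequently_hasStrip (hκ : 0 < κ) (hR : 1 ≤ R) :
    ∀ᵐ ξ ∂familyLaw, ∃ᶠ k in atTop, HasStrip κ R ξ k := by
  set c := ENNReal.ofReal (1 - Real.exp (-κ ^ 2)) *
      ENNReal.ofReal (Real.exp (-(2 * (2 * (9 * (R * R)))))) with hc
  have hc0 : 0 < c := by
    refine ENNReal.mul_pos (ENNReal.ofReal_pos.2 ?_).ne'
      (ENNReal.ofReal_pos.2 (Real.exp_pos _)).ne'
    have : Real.exp (-κ ^ 2) < 1 := Real.exp_lt_one_iff.2 (by nlinarith)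
    linarith
  set U : ℕ+ → Set (Site → Bool) := fun n => ⋃ k, ⋃ (_ : n ≤ k), {ξ | HasStrip κ R ξ k} with hU
  have hUm : ∀ (n : ℕ+) (S : Set Site), (∀ i : Site, n ≤ i.2.1 → i ∈ S) →
      MeasurableSet[cylinderEvents (X := fun _ : Site => Bool) S] (U n) := by
    intro n S hS
    exact MeasurableSet.iUnion fun k => MeasurableSet.iUnion fun hk =>
      measurableSet_hasStrip κ R k fun j k' l m hk' => hS _ (hk.trans hk')
  have hUanti : Antitone U := fun n n' h =>
    Set.iUnion_mono fun k => Set.iUnion_subset fun hk => Set.subset_iUnion_of_subset (h.trans hk)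
      subset_rfl
  have hset : ∀ n₀ : ℕ+, {ξ | ∃ᶠ k in atTop, HasStrip κ R ξ k} = ⋂ n, U (max n₀ n) := by
    intro n₀
    ext ξ
    simp only [hU, Set.mem_ofPred_eq, Set.mem_iInter, Set.mem_iUnion, exists_prop, frequently_atTop]
    exact ⟨fun h n => h _, fun h n => (h n).imp fun k hk => ⟨(le_max_right _ _).trans hk.1, hk.2⟩⟩
  have hUm' : ∀ n, MeasurableSet (U n) := fun n => by
    have := hUm n Set.univ fun _ _ => trivial
    rwa [cylinderEvents_univ] at this
  have hm : MeasurableSet {ξ | ∃ᶠ k in atTop, HasStrip κ R ξ k} := by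
    rw [hset 1]
    exact MeasurableSet.iInter fun n => hUm' _
  have hpos : c ≤ familyLaw {ξ | ∃ᶠ k in atTop, HasStrip κ R ξ k} := by
    have hlim := tendsto_measure_iInter_atTop (μ := familyLaw)
      (fun n => (hUm' (max 1 n)).nullMeasurableSet)
      (fun n n' h => hUanti (max_le_max le_rfl h)) ⟨1, measure_ne_top _ _⟩
    rw [← hset 1] at hlim
    refine ge_of_tendsto hlim (Eventually.of_forall fun n => ?_)
    refine (le_familyLaw_hasStrip hκ hR (max 1 n)).trans (measure_mono ?_)
    exact Set.subset_iUnion_of_subset (max 1 n) (Set.subset_iUnion_of_subset le_rfl subset_rfl)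
  have h01 := measure_zero_or_one_of_measurableSet_limsup (μ := familyLaw)
    (s := fun i : Site => MeasurableSpace.comap (fun ξ : Site → Bool => ξ i) inferInstance)
    (f := cofinite) (p := Set.Finite) (ns := fun s : Finset Site => (s : Set Site))
    (t := {ξ | ∃ᶠ k in atTop, HasStrip κ R ξ k})
    (fun i => (measurable_pi_apply i).comap_le) iIndepFun_familyLaw.iIndep
    (fun t ht => ht.compl_mem_cofinite) (Monotone.directed_le fun s t h => Finset.coe_subset.2 h)
    (fun s => s.finite_toSet) (fun i => ⟨{i}, by simp⟩) ?_
  · rcases h01 with h | h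
    · rw [h] at hpos
      exact absurd hpos (not_le.2 hc0)
    · exact (mem_ae_iff_prob_eq_one hm).2 h
  · rw [limsup_eq_iInf_iSup]
    refine MeasurableSpace.measurableSet_iInf.2 fun S =>
      MeasurableSpace.measurableSet_iInf.2 fun hS => ?_
    -- Finitely many sites have bounded levels, so a cofinite `S` contains all sites of large level.
    obtain ⟨n₀, hn₀⟩ : ∃ n₀ : ℕ+, ∀ i : Site, n₀ ≤ i.2.1 → i ∈ S := by
      have hfin : (Sᶜ).Finite := mem_cofinite.1 hS
      obtain ⟨M, hM⟩ := (hfin.image fun i : Site => i.2.1).bddAbove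
      refine ⟨M + 1, fun i hi => ?_⟩
      by_contra hn
      exact absurd (hM (Set.mem_image_of_mem _ hn)) (not_le.2 ((PNat.lt_add_right M 1).trans_le hi))
    rw [hset n₀]
    exact MeasurableSet.iInter fun n => hUm _ S fun i hi => hn₀ i ((le_max_left _ _).trans hi)

/-! ### Stationarity and ergodicity of the environment -/

section transfer

variable {Ω Ω' : Type*} [MeasurableSpace Ω] [MeasurableSpace Ω'] {P : Measure Ω} {Q : Measure Ω'}
  {φ : Ω → Ω'}

theorem MeasurePreserving.ae_comp_iff (hφ : MeasurePreserving φ P Q) {p : Ω' → Prop}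
    (hp : NullMeasurableSet {ξ | p ξ} Q) : (∀ᵐ ω ∂P, p (φ ω)) ↔ ∀ᵐ ξ ∂Q, p ξ := by
  rw [ae_iff, ae_iff]
  have := hφ.measure_preimage hp.compl
  rw [← show P {ω | ¬ p (φ ω)} = Q {ξ | ¬ p ξ} from this]

theorem MeasurePreserving.identDistrib_comp (hφ : MeasurePreserving φ P Q) {E : Type*}
    [MeasurableSpace E] {c : Ω' → E} (hc : AEMeasurable c Q) :
    IdentDistrib (fun ω => c (φ ω)) c P Q where
  aemeasurable_fst := hc.comp_quasiMeasurePreserving hφ.quasiMeasurePreserving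
  aemeasurable_snd := hc
  map_eq := by
    have h := AEMeasurable.map_map_of_aemeasurable (hφ.map_eq.symm ▸ hc) hφ.measurable.aemeasurable
    rw [hφ.map_eq] at h
    exact h.symm

theorem NullMeasurableSet.setOf_iff {p q : Ω → Prop} (hp : NullMeasurableSet {ω | p ω} P)
    (hq : NullMeasurableSet {ω | q ω} P) : NullMeasurableSet {ω | p ω ↔ q ω} P := by
  have : {ω | p ω ↔ q ω} = ({ω | p ω} ∩ {ω | q ω}) ∪ ({ω | p ω}ᶜ ∩ {ω | q ω}ᶜ) := by
    ext ω
    simp only [Set.mem_ofPred_eq, Set.mem_union, Set.mem_inter_iff, Set.mem_compl_iff]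
    tauto
  rw [this]
  exact (hp.inter hq).union (hp.compl.inter hq.compl)

theorem IsStationaryErgodic.comp {c : Ω' → Plane → ℝ} {G : Set Plane}
    (hc : IsStationaryErgodic Q c G) (hφ : MeasurePreserving φ P Q) :
    IsStationaryErgodic P (fun ω => c (φ ω)) G where
  aemeasurable := hc.aemeasurable.comp_quasiMeasurePreserving hφ.quasiMeasurePreserving
  stationary z hz :=
    (MeasurePreserving.identDistrib_comp hφ (hc.stationary z hz).aemeasurable_fst).trans
      ((hc.stationary z hz).trans (MeasurePreserving.identDistrib_comp hφ hc.aemeasurable).symm)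
  ergodic A hA hinv := by
    have h := hc.ergodic A hA fun z hz =>
      (MeasurePreserving.ae_comp_iff hφ (NullMeasurableSet.setOf_iff
        ((hc.stationary z hz).aemeasurable_fst.nullMeasurableSet_preimage hA)
        (hc.aemeasurable.nullMeasurableSet_preimage hA))).1 (hinv z hz)
    exact h.imp hφ.quasiMeasurePreserving.ae hφ.quasiMeasurePreserving.ae

end transfer

variable {lam mu : ℝ}

theorem aemeasurable_weight (hlam : 0 ≤ lam) (hmu : 0 ≤ mu) :
    AEMeasurable (weight lam mu) familyLaw := by
  obtain ⟨W, hW, -, hae⟩ := exists_measurable_weight hlam hmu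
  exact ⟨W, hW, hae⟩

theorem latticePoint_mem (n : ℤ × ℤ) : latticePoint n ∈ integerLattice := by
  intro i
  fin_cases i
  exacts [⟨n.1, rfl⟩, ⟨n.2, rfl⟩]

theorem exists_latticePoint_eq {z : Plane} (hz : z ∈ integerLattice) :
    ∃ n, latticePoint n = z := by
  obtain ⟨a, ha⟩ := hz 0
  obtain ⟨b, hb⟩ := hz 1
  refine ⟨(a, b), ?_⟩
  ext i
  fin_cases i
  exacts [ha.symm, hb.symm]

theorem weight_add_latticePoint (n : ℤ × ℤ) :
    (fun (ξ : Site → Bool) x => weight lam mu ξ (x + latticePoint n)) =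
      fun ξ => weight lam mu (shift n ξ) :=
  funext fun ξ => funext fun x => (weight_shift lam mu n ξ x).symm

/-- Lattice translations of the field are shifts of the configuration; the measurable version `W`
turns events on fields into measurable events on configurations. -/
theorem isStationaryErgodic_weight (hlam : 0 ≤ lam) (hmu : 0 ≤ mu) :
    IsStationaryErgodic familyLaw (weight lam mu) integerLattice where
  aemeasurable := aemeasurable_weight hlam hmu
  stationary z hz := by
    obtain ⟨n, rfl⟩ := exists_latticePoint_eq hz
    rw [weight_add_latticePoint]
    exact MeasurePreserving.identDistrib_comp (measurePreserving_shift n)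
      (aemeasurable_weight hlam hmu)
  ergodic A hA hinv := by
    obtain ⟨W, hW, -, hae⟩ := exists_measurable_weight hlam hmu
    have hB : W ⁻¹' A =ᵐ[familyLaw] weight lam mu ⁻¹' A :=
      (hae.mono fun ξ hξ => by
        change (W ξ ∈ A) = (weight lam mu ξ ∈ A)
        rw [hξ])
    have hinv' : ∀ n, shift n ⁻¹' (W ⁻¹' A) =ᵐ[familyLaw] W ⁻¹' A := by
      intro n
      refine ((measurePreserving_shift n).quasiMeasurePreserving.preimage_ae_eq hB).trans
        (EventuallyEq.trans ?_ hB.symm)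
      refine (hinv _ (latticePoint_mem n)).mono fun ξ hξ => ?_
      change (weight lam mu (shift n ξ) ∈ A) = (weight lam mu ξ ∈ A)
      rw [← hξ, funext (weight_shift lam mu n ξ)]
    rcases measure_eq_zero_or_one_of_shift_invariant (hW hA) hinv' with h | h
    · right
      filter_upwards [hae, measure_eq_zero_iff_ae_notMem.1 h] with ξ h1 h2
      rwa [h1]
    · left
      filter_upwards [hae, (mem_ae_iff_prob_eq_one (hW hA)).2 h] with ξ h1 h2
      rwa [h1]

/-! ### The environment shifted by a uniform point of the unit square -/

/-- The law of a uniform point of the torus `ℝ² / ℤ²`. -/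
noncomputable def torusLaw : Measure (UnitAddCircle × UnitAddCircle) :=
  AddCircle.haarAddCircle.prod AddCircle.haarAddCircle

instance : IsProbabilityMeasure torusLaw := by
  unfold torusLaw
  infer_instance

instance : torusLaw.IsAddLeftInvariant := by
  unfold torusLaw
  infer_instance

instance : torusLaw.IsAddRightInvariant := by
  unfold torusLaw
  infer_instance

/-- The representative in `[0, 1)` of a point of the circle. -/
noncomputable def circleRep (t : UnitAddCircle) : ℝ := AddCircle.equivIco 1 0 t

theorem circleRep_nonneg (t : UnitAddCircle) : 0 ≤ circleRep t :=
  (AddCircle.equivIco 1 0 t).2.1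

theorem circleRep_lt_one (t : UnitAddCircle) : circleRep t < 1 :=
  (AddCircle.equivIco 1 0 t).2.2.trans_eq (zero_add 1)

theorem coe_circleRep (t : UnitAddCircle) : ((circleRep t : ℝ) : UnitAddCircle) = t :=
  (AddCircle.equivIco 1 0).symm_apply_apply t

theorem circleRep_coe (x : ℝ) : circleRep (x : UnitAddCircle) = Int.fract x := by
  rw [circleRep, AddCircle.coe_equivIco_mk_apply]
  simp

theorem circleRep_add (t : UnitAddCircle) (s : ℝ) :
    circleRep (t + s) = circleRep t + s - ⌊circleRep t + s⌋ := by
  conv_lhs => rw [← coe_circleRep t, ← AddCircle.coe_add, circleRep_coe]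
  rfl

theorem measurable_circleRep : Measurable circleRep :=
  measurable_subtype_coe.comp (AddCircle.measurableEquivIco 1 0).measurable

/-- The representative in `[0, 1)²` of a point of the torus. -/
noncomputable def torusRep (θ : UnitAddCircle × UnitAddCircle) : Plane :=
  !₂[circleRep θ.1, circleRep θ.2]

theorem measurable_torusRep : Measurable torusRep := by
  refine (WithLp.measurable_toLp 2 (Fin 2 → ℝ)).comp (measurable_pi_iff.2 fun i => ?_)
  fin_cases i
  exacts [measurable_circleRep.comp measurable_fst, measurable_circleRep.comp measurable_snd]

theorem abs_torusRep_le (θ : UnitAddCircle × UnitAddCircle) (i : Fin 2) : |torusRep θ i| ≤ 1 := by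
  have h : ∀ t, |circleRep t| ≤ 1 := fun t => by
    rw [abs_of_nonneg (circleRep_nonneg t)]
    exact (circleRep_lt_one t).le
  fin_cases i
  exacts [h _, h _]

/-- The class of a point of the plane in the torus. -/
noncomputable def toTorus (z : Plane) : UnitAddCircle × UnitAddCircle := ((z 0 : ℝ), (z 1 : ℝ))

theorem toTorus_torusRep (θ : UnitAddCircle × UnitAddCircle) : toTorus (torusRep θ) = θ :=
  Prod.ext (coe_circleRep θ.1) (coe_circleRep θ.2)

/-- The integer part of `torusRep θ + z`. -/
noncomputable def carry (z : Plane) (θ : UnitAddCircle × UnitAddCircle) : ℤ × ℤ :=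
  (⌊circleRep θ.1 + z 0⌋, ⌊circleRep θ.2 + z 1⌋)

theorem measurable_carry (z : Plane) : Measurable (carry z) :=
  (Int.measurable_floor.comp ((measurable_circleRep.comp measurable_fst).add_const _)).prodMk
    (Int.measurable_floor.comp ((measurable_circleRep.comp measurable_snd).add_const _))

/-- Translating by `z` rotates the torus point; the integer part lost in reducing to `[0, 1)²` is
passed to the configuration as a lattice shift. -/
theorem torusRep_add (θ : UnitAddCircle × UnitAddCircle) (z : Plane) :
    torusRep (θ + toTorus z) + latticePoint (carry z θ) = torusRep θ + z := by
  ext i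
  fin_cases i
  · exact (congrArg (· + _) (circleRep_add θ.1 (z 0))).trans (sub_add_cancel _ _)
  · exact (congrArg (· + _) (circleRep_add θ.2 (z 1))).trans (sub_add_cancel _ _)

theorem toTorus_latticePoint (n : ℤ × ℤ) : toTorus (latticePoint n) = 0 := by
  have h : ∀ m : ℤ, ((m : ℝ) : UnitAddCircle) = 0 := fun m =>
    (AddCircle.coe_eq_zero_iff 1).2 ⟨m, by simp⟩
  exact Prod.ext (h n.1) (h n.2)

/-- Together with `toTorus_latticePoint`: lattice translations fix the torus point and act on the
configuration alone. -/
theorem carry_latticePoint (n : ℤ × ℤ) (θ : UnitAddCircle × UnitAddCircle) :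
    carry (latticePoint n) θ = n := by
  have h : ∀ (t : UnitAddCircle) (m : ℤ), ⌊circleRep t + (m : ℝ)⌋ = m := fun t m => by
    rw [Int.floor_add_intCast, Int.floor_eq_zero_iff.2 ⟨circleRep_nonneg t, circleRep_lt_one t⟩,
      zero_add]
  exact Prod.ext (h _ _) (h _ _)

/-- The action of a translation of the plane on a point of the torus and a configuration. -/
noncomputable def torusShift (z : Plane) (ω : (UnitAddCircle × UnitAddCircle) × (Site → Bool)) :
    (UnitAddCircle × UnitAddCircle) × (Site → Bool) :=
  (ω.1 + toTorus z, shift (carry z ω.1) ω.2)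

theorem measurable_shift_uncurry :
    Measurable fun p : (ℤ × ℤ) × (Site → Bool) => shift p.1 p.2 :=
  measurable_from_prod_countable_right fun n => (measurePreserving_shift n).measurable

/-- A skew product: a rotation of the base, with law-preserving shifts in the fibres. -/
theorem measurePreserving_torusShift (z : Plane) :
    MeasurePreserving (torusShift z) (torusLaw.prod familyLaw) (torusLaw.prod familyLaw) :=
  (measurePreserving_add_right torusLaw (toTorus z)).skew_product
    (g := fun θ ξ => shift (carry z θ) ξ)
    (measurable_shift_uncurry.comp
      (((measurable_carry z).comp measurable_fst).prodMk measurable_snd))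
    (Eventually.of_forall fun _ => (measurePreserving_shift _).map_eq)

/-- The environment of the configuration `ω.2`, shifted by the point `ω.1` of the torus. -/
noncomputable def shiftedField (w : (Site → Bool) → Plane → ℝ)
    (ω : (UnitAddCircle × UnitAddCircle) × (Site → Bool)) (x : Plane) : ℝ :=
  w ω.2 (x + torusRep ω.1)

theorem shiftedField_torusShift (z : Plane)
    (ω : (UnitAddCircle × UnitAddCircle) × (Site → Bool)) :
    shiftedField (weight lam mu) (torusShift z ω) =
      fun x => shiftedField (weight lam mu) ω (x + z) := by
  funext x
  simp only [shiftedField, torusShift]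
  rw [weight_shift, add_assoc, torusRep_add, add_assoc, add_comm z]

/-- A function continuous in `x` and measurable in `ξ` is jointly measurable, so a random point may
be inserted. -/
theorem measurable_shiftedField {W : (Site → Bool) → Plane → ℝ} (hW : Measurable W)
    (hWc : ∀ ξ, Continuous (W ξ)) : Measurable (shiftedField W) := by
  have h : Measurable (Function.uncurry fun (x : Plane) ξ => W ξ x) :=
    measurable_uncurry_of_continuous_of_measurable hWc fun x => measurable_pi_iff.1 hW x
  refine measurable_pi_iff.2 fun x => ?_
  exact h.comp (((measurable_torusRep.comp measurable_fst).const_add x).prodMk measurable_snd)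

theorem shiftedField_ae_eq {w W : (Site → Bool) → Plane → ℝ} (h : w =ᵐ[familyLaw] W) :
    shiftedField w =ᵐ[torusLaw.prod familyLaw] shiftedField W :=
  (Measure.quasiMeasurePreserving_snd.ae h).mono fun ω hω => by
    funext x
    simp only [shiftedField, hω]

/-- A measurable set which is almost surely invariant under all `torusShift z` is trivial. -/
theorem ae_mem_or_ae_notMem_of_torusShift_invariant
    {B : Set ((UnitAddCircle × UnitAddCircle) × (Site → Bool))} (hB : MeasurableSet B)
    (hinv : ∀ z, ∀ᵐ ω ∂torusLaw.prod familyLaw, torusShift z ω ∈ B ↔ ω ∈ B) :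
    (∀ᵐ ω ∂torusLaw.prod familyLaw, ω ∈ B) ∨ ∀ᵐ ω ∂torusLaw.prod familyLaw, ω ∉ B := by
  set b : UnitAddCircle × UnitAddCircle → ENNReal := fun θ => familyLaw (Prod.mk θ ⁻¹' B) with hb
  have hbm : Measurable b := measurable_measure_prodMk_left hB
  have hsec : ∀ θ, MeasurableSet (Prod.mk θ ⁻¹' B) := fun θ => measurable_prodMk_left hB
  -- Lattice translations preserve the fibres, so almost every section of `B` is invariant under all
  -- of the countably many shifts and lattice ergodicity applies.
  have h01 : ∀ᵐ θ ∂torusLaw, b θ = 0 ∨ b θ = 1 := by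
    have h := ae_all_iff.2 fun n => Measure.ae_ae_of_ae_prod (hinv (latticePoint n))
    filter_upwards [h] with θ hθ
    refine measure_eq_zero_or_one_of_shift_invariant (hsec θ) fun n => ?_
    refine (hθ n).mono fun ξ hξ => ?_
    rw [torusShift, toTorus_latticePoint, carry_latticePoint, add_zero] at hξ
    exact propext hξ
  have hconst : ∀ t, ∀ᵐ θ ∂torusLaw, b (θ + t) = b θ := by
    intro t
    filter_upwards [Measure.ae_ae_of_ae_prod (hinv (torusRep t))] with θ hθ
    simp only [torusShift, toTorus_torusRep] at hθ
    rw [hb]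
    simp only
    rw [← (measurePreserving_shift (carry (torusRep t) θ)).measure_preimage
      (hsec (θ + t)).nullMeasurableSet]
    exact measure_congr (hθ.mono fun ξ hξ => propext hξ)
  have hmeas : MeasurableSet {x : (UnitAddCircle × UnitAddCircle) × (UnitAddCircle × UnitAddCircle) |
      b (x.2 + x.1) = b x.2} :=
    measurableSet_eq_fun (hbm.comp (measurable_snd.add measurable_fst)) (hbm.comp measurable_snd)
  -- The exceptional set in `hconst` depends on `t`. Fubini provides one `θ₀` with `b (θ₀ + t) = b
  -- θ₀` for almost every `t`, so `b` is almost everywhere constant.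
  have hcomm := (Measure.ae_ae_comm (μ := torusLaw) (ν := torusLaw)
    (p := fun t θ => b (θ + t) = b θ) hmeas).1 (Eventually.of_forall hconst)
  obtain ⟨θ₀, h1, h2⟩ := (hcomm.and h01).exists
  have hae : ∀ᵐ θ ∂torusLaw, b θ = b θ₀ := by
    have := (measurePreserving_add_left torusLaw (-θ₀)).quasiMeasurePreserving.ae h1
    simpa using this
  rcases h2 with h2 | h2
  · right
    refine measure_eq_zero_iff_ae_notMem.1 ((Measure.measure_prod_null hB).2 ?_)
    exact hae.mono fun θ hθ => hθ.trans h2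
  · left
    have : (torusLaw.prod familyLaw) Bᶜ = 0 := by
      refine (Measure.measure_prod_null hB.compl).2 (hae.mono fun θ hθ => ?_)
      exact (prob_compl_eq_zero_iff (hsec θ)).2 (hθ.trans h2)
    exact this

theorem isStationaryErgodic_shiftedField (hlam : 0 ≤ lam) (hmu : 0 ≤ mu) :
    IsStationaryErgodic (torusLaw.prod familyLaw) (shiftedField (weight lam mu)) Set.univ := by
  obtain ⟨W, hW, hWc, hae⟩ := exists_measurable_weight hlam hmu
  have hm := measurable_shiftedField hW hWc
  have hae' := shiftedField_ae_eq hae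
  have haem : AEMeasurable (shiftedField (weight lam mu)) (torusLaw.prod familyLaw) := ⟨_, hm, hae'⟩
  refine ⟨haem, fun z _ => ?_, fun A hA hinv => ?_⟩
  · have := MeasurePreserving.identDistrib_comp (measurePreserving_torusShift z) haem
    simpa only [shiftedField_torusShift] using this
  · have h := ae_mem_or_ae_notMem_of_torusShift_invariant (hm hA) fun z => ?_
    · refine h.imp (fun h => ?_) fun h => ?_
      all_goals
        filter_upwards [h, hae'] with ω h1 h2
        rw [h2]
        exact h1
    · filter_upwards [hinv z trivial, hae',
        (measurePreserving_torusShift z).quasiMeasurePreserving.ae hae'] with ω h1 h2 h3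
      rw [Set.mem_preimage, Set.mem_preimage, ← h2, ← h3, shiftedField_torusShift]
      exact h1

/-! ### The Hamiltonians -/

/-- The sup norm of a point of the plane. -/
noncomputable def supNorm (p : Plane) : ℝ := max |p 0| |p 1|

theorem lipschitzWith_abs_coord (i : Fin 2) : LipschitzWith 1 fun p : Plane => |p i| :=
  LipschitzWith.of_le_add fun p p' => by
    linarith [abs_sub_abs_le_abs_sub (p i) (p' i), abs_coord_sub_le p p' i]

theorem lipschitzWith_supNorm : LipschitzWith 1 supNorm := by
  have h := (lipschitzWith_abs_coord 0).max (lipschitzWith_abs_coord 1)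
  rw [max_self] at h
  exact h

theorem supNorm_le_norm (p : Plane) : supNorm p ≤ ‖p‖ := by
  have h : ∀ i, |p i| ≤ ‖p‖ := fun i => by
    have := abs_coord_sub_le p 0 i
    rwa [dist_zero_right, PiLp.zero_apply, sub_zero] at this
  exact max_le (h 0) (h 1)

theorem norm_le_two_mul_supNorm (p : Plane) : ‖p‖ ≤ 2 * supNorm p := by
  have h0 : |p 0| ≤ supNorm p := le_max_left _ _
  have h1 : |p 1| ≤ supNorm p := le_max_right _ _
  have hs : 0 ≤ supNorm p := (abs_nonneg _).trans h0
  rw [EuclideanSpace.norm_eq, Fin.sum_univ_two, Real.norm_eq_abs, Real.norm_eq_abs]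
  refine Real.sqrt_le_iff.2 ⟨by positivity, ?_⟩
  nlinarith [pow_le_pow_left₀ (abs_nonneg _) h0 2, pow_le_pow_left₀ (abs_nonneg _) h1 2]

theorem neg_supNorm_le (p : Plane) : -supNorm p ≤ |p 1| - |p 0| := by
  have h0 : |p 0| ≤ supNorm p := le_max_left _ _
  linarith [abs_nonneg (p 1)]

theorem saddle_eq_of_abs_le {q : ℝ} (hq : 1 < q) (p : Plane) (h0 : |p 0| ≤ 2) (h1 : |p 1| ≤ 2) :
    saddle q p = |p 1| - |p 0| := by
  rw [saddle, max_eq_right (by linarith [max_le h0 h1] : max |p 0| |p 1| - 2 ≤ 0),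
    Real.zero_rpow (by linarith), add_zero]

theorem locallyLipschitz_saddle {q : ℝ} (hq : 1 < q) : LocallyLipschitz (saddle q) := by
  have h1 : LocallyLipschitz fun s : ℝ => s ^ q := by
    have : ContDiff ℝ ((1 : ℕ) : WithTop ℕ∞) fun s : ℝ => s ^ q :=
      Real.contDiff_rpow_const_of_le (by simpa using hq.le)
    exact ContDiff.locallyLipschitz (by exact_mod_cast this)
  have h2 : LipschitzWith (1 + 0) fun p : Plane => max (supNorm p - 2) 0 :=
    (lipschitzWith_supNorm.sub (LipschitzWith.const 2)).max_const 0
  have h3 := (lipschitzWith_abs_coord 1).sub (lipschitzWith_abs_coord 0)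
  exact h3.locallyLipschitz.add (h1.comp h2.locallyLipschitz)

theorem tendsto_saddle_div_norm {q : ℝ} (hq : 1 < q) :
    Tendsto (fun p => saddle q p / ‖p‖) (cocompact Plane) atTop := by
  have hn : Tendsto (fun p : Plane => ‖p‖) (cocompact Plane) atTop := tendsto_norm_cocompact_atTop
  have h1 : Tendsto (fun r : ℝ => -1 + r ^ (q - 1) / 4 ^ q) atTop atTop :=
    tendsto_atTop_add_const_left _ _
      ((tendsto_rpow_atTop (by linarith)).atTop_div_const (by positivity))
  refine tendsto_atTop_mono' _ ?_ (h1.comp hn)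
  -- For `‖p‖ ≥ 8` one has `supNorm p - 2 ≥ ‖p‖ / 2 - 2 ≥ ‖p‖ / 4`.
  filter_upwards [hn.eventually_ge_atTop 8] with p hp
  have hp0 : 0 < ‖p‖ := by linarith
  have h2 := norm_le_two_mul_supNorm p
  have h3 := supNorm_le_norm p
  have h4 := neg_supNorm_le p
  have h5 : (‖p‖ / 4) ^ q ≤ max (supNorm p - 2) 0 ^ q :=
    Real.rpow_le_rpow (by positivity) (le_max_of_le_left (by linarith)) (by linarith)
  rw [Real.div_rpow hp0.le (by norm_num)] at h5
  rw [Function.comp_apply, le_div_iff₀ hp0, Real.rpow_sub_one hp0.ne']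
  have e : (-1 + ‖p‖ ^ q / ‖p‖ / 4 ^ q) * ‖p‖ = -‖p‖ + ‖p‖ ^ q / 4 ^ q := by
    field_simp
  rw [e]
  change _ ≤ |p 1| - |p 0| + max (supNorm p - 2) 0 ^ q
  linarith

theorem tendsto_saddle {q : ℝ} (hq : 1 < q) : Tendsto (saddle q) (cocompact Plane) atTop := by
  have hn : Tendsto (fun p : Plane => ‖p‖) (cocompact Plane) atTop := tendsto_norm_cocompact_atTop
  refine ((tendsto_saddle_div_norm hq).atTop_mul_atTop₀ hn).congr' ?_
  filter_upwards [hn.eventually_gt_atTop 0] with p hp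
  exact div_mul_cancel₀ _ hp.ne'

/-- The midpoint inequality fails at 0 between `(1, 0)` and `(-1, 0)`, where `h` equals `-1`. -/
theorem not_convexOn_of_eq_saddle {h : Plane → ℝ}
    (hh : ∀ p : Plane, |p 0| ≤ 2 → |p 1| ≤ 2 → h p = |p 1| - |p 0|) :
    ¬ ConvexOn ℝ Set.univ h := by
  intro hc
  have h1 := hc.2 (Set.mem_univ !₂[1, 0]) (Set.mem_univ !₂[-1, 0])
    (by norm_num : (0 : ℝ) ≤ 1 / 2) (by norm_num : (0 : ℝ) ≤ 1 / 2) (by norm_num)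
  have e : (1 / 2 : ℝ) • (!₂[1, 0] : Plane) + (1 / 2 : ℝ) • !₂[-1, 0] = 0 := by
    ext i
    fin_cases i <;> simp
  rw [e, hh _ (by simp) (by simp), hh _ (by norm_num) (by norm_num),
    hh _ (by norm_num) (by norm_num)] at h1
  norm_num at h1

/-- A globally Lipschitz variant of `saddle`. -/
noncomputable def linearSaddle (p : Plane) : ℝ :=
  |p 1| - |p 0| + (max (supNorm p - 2) 0 + max (supNorm p - 2) 0)

theorem linearSaddle_eq_of_abs_le (p : Plane) (h0 : |p 0| ≤ 2) (h1 : |p 1| ≤ 2) :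
    linearSaddle p = |p 1| - |p 0| := by
  have : supNorm p ≤ 2 := max_le h0 h1
  rw [linearSaddle, max_eq_right (by linarith), add_zero, add_zero]

theorem exists_lipschitzWith_linearSaddle : ∃ K, LipschitzWith K linearSaddle := by
  have h2 : LipschitzWith (1 + 0) fun p : Plane => max (supNorm p - 2) 0 :=
    (lipschitzWith_supNorm.sub (LipschitzWith.const 2)).max_const 0
  exact ⟨_, ((lipschitzWith_abs_coord 1).sub (lipschitzWith_abs_coord 0)).add (h2.add h2)⟩

theorem tendsto_linearSaddle : Tendsto linearSaddle (cocompact Plane) atTop := by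
  have hn : Tendsto (fun p : Plane => 1 / 2 * ‖p‖ + -4) (cocompact Plane) atTop :=
    tendsto_atTop_add_const_right _ _
      ((tendsto_norm_cocompact_atTop (E := Plane)).const_mul_atTop (by norm_num))
  -- One copy of the excess only compensates `-|p 0|`; the second gives coercivity, through the
  -- lower bound `supNorm p - 4`.
  refine tendsto_atTop_mono (fun p => ?_) hn
  have h1 := norm_le_two_mul_supNorm p
  have h2 := neg_supNorm_le p
  have h3 := le_max_left (supNorm p - 2) 0
  rw [linearSaddle]
  linarith

/-! ### Non-homogenization -/

theorem ae_frequently_hasStrip_and_swap {κ R : ℝ} (hκ : 0 < κ) (hR : 1 ≤ R) :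
    ∀ᵐ ξ ∂familyLaw, (∃ᶠ k in atTop, HasStrip κ R ξ k) ∧
      ∃ᶠ k in atTop, HasStrip κ R (ξ ∘ siteSwap) k :=
  (ae_frequently_hasStrip hκ hR).and
    (measurePreserving_siteSwap.quasiMeasurePreserving.ae (ae_frequently_hasStrip hκ hR))

end ViscousHJ

open ViscousHJ in
theorem mainTheorem1 :
    (∀ (η lam mu q : ℝ), 0 < η → η < 1 / 2 → 16 / η ≤ lam → 16 / η ≤ mu → 1 < q →
      ∀ (Ω : Type*) [MeasurableSpace Ω] (P : Measure Ω) [IsProbabilityMeasure P]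
        (X : ViscousHJ.Site → Ω → Bool), ViscousHJ.IsBernoulliFamily P X →
        -- the random field
        (∀ ω x, |ViscousHJ.environment lam mu X ω x| ≤ 1 / 2) ∧
        (∀ ω, LipschitzWith 1 (ViscousHJ.environment lam mu X ω)) ∧
        ViscousHJ.IsStationaryErgodic P (ViscousHJ.environment lam mu X)
          ViscousHJ.integerLattice ∧
        -- the Hamiltonian
        LocallyLipschitz (ViscousHJ.saddle q) ∧
        Tendsto (ViscousHJ.saddle q) (cocompact ViscousHJ.Plane) atTop ∧
        Tendsto (fun p => ViscousHJ.saddle q p / ‖p‖) (cocompact ViscousHJ.Plane) atTop ∧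
        ¬ ConvexOn ℝ Set.univ (ViscousHJ.saddle q) ∧
        -- the solutions
        ∀ᵐ ω ∂P, ∀ u : ℝ → ℝ → ViscousHJ.Plane → ℝ,
          ViscousHJ.IsSolutionFamily (ViscousHJ.saddle q) (ViscousHJ.environment lam mu X ω) u →
          liminf (fun ε => (u ε 1 0 : EReal)) (𝓝[>] (0 : ℝ)) ≤ ((-(1 / 2) + η : ℝ) : EReal) ∧
          ((1 / 2 - η : ℝ) : EReal) ≤ limsup (fun ε => (u ε 1 0 : EReal)) (𝓝[>] (0 : ℝ)) ∧
          ¬ ∃ l : ℝ, Tendsto (fun ε => u ε 1 0) (𝓝[>] (0 : ℝ)) (𝓝 l)) ∧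
    -- a globally Lipschitz Hamiltonian and a field that is stationary for all translations
    (∃ (h : ViscousHJ.Plane → ℝ) (K : NNReal),
      LipschitzWith K h ∧ Tendsto h (cocompact ViscousHJ.Plane) atTop ∧
      ¬ ConvexOn ℝ Set.univ h ∧
      ∃ (Ω : Type) (_ : MeasurableSpace Ω) (P : Measure Ω) (_ : IsProbabilityMeasure P)
        (c : Ω → ViscousHJ.Plane → ℝ) (M : ℝ) (L : NNReal),
        (∀ ω x, |c ω x| ≤ M) ∧ (∀ ω, LipschitzWith L (c ω)) ∧
        ViscousHJ.IsStationaryErgodic P c Set.univ ∧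
        ∀ᵐ ω ∂P, ∀ u : ℝ → ℝ → ViscousHJ.Plane → ℝ,
          ViscousHJ.IsSolutionFamily h (c ω) u →
          ¬ ∃ l : ℝ, Tendsto (fun ε => u ε 1 0) (𝓝[>] (0 : ℝ)) (𝓝 l)) := by
  refine ⟨?_, ?_⟩
  · intro η lam mu q hη hη' hlam hmu hq Ω _ P _ X hX
    have h16 : 16 ≤ 16 / η := by
      rw [le_div_iff₀ hη]
      linarith
    have hlam0 : 0 ≤ lam := by linarith
    have hmu0 : 0 ≤ mu := by linarith
    refine ⟨fun ω => abs_weight_le lam mu _, fun ω => lipschitzWith_weight lam mu _,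
      (isStationaryErgodic_weight hlam0 hmu0).comp hX.measurePreserving,
      locallyLipschitz_saddle hq, tendsto_saddle hq, tendsto_saddle_div_norm hq,
      not_convexOn_of_eq_saddle (saddle_eq_of_abs_le hq), ?_⟩
    have hae := ae_frequently_hasStrip_and_swap (κ := η / 100) (R := η / 100 + lam + mu + 1)
      (by positivity) (by linarith)
    filter_upwards [hX.measurePreserving.quasiMeasurePreserving.ae hae] with ω hω u hu
    have hu' : IsSolutionFamily (saddle q)
        (fun y => weight lam mu (fun i => X i ω) (y + 0)) u := by
      simp only [add_zero]
      exact hu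
    have h1 := hu'.frequently_le hη hη' hlam hmu (by simp) (saddle_eq_of_abs_le hq) hω.1
    have h2 := hu'.frequently_ge hη hη' hlam hmu (by simp) (saddle_eq_of_abs_le hq) hω.2
    exact ⟨liminf_le_of_frequently_le' (h1.mono fun ε h => EReal.coe_le_coe_iff.2 h),
      le_limsup_of_frequently_le' (h2.mono fun ε h => EReal.coe_le_coe_iff.2 h),
      not_tendsto_of_frequently (by linarith) h1 h2⟩
  · obtain ⟨K, hK⟩ := exists_lipschitzWith_linearSaddle
    -- The choice is `η = 1/4`, for which `16 / η = 64`; the values then oscillate at least between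
    -- `-1/4` and `1/4`.
    refine ⟨linearSaddle, K, hK, tendsto_linearSaddle,
      not_convexOn_of_eq_saddle linearSaddle_eq_of_abs_le,
      (UnitAddCircle × UnitAddCircle) × (Site → Bool), inferInstance, torusLaw.prod familyLaw,
      inferInstance, shiftedField (weight 64 64), 1 / 2, 1, fun ω x => abs_weight_le 64 64 _ _,
      fun ω => ?_, isStationaryErgodic_shiftedField (by norm_num) (by norm_num), ?_⟩
    · refine LipschitzWith.of_le_add fun x y => ?_
      have := (lipschitzWith_weight 64 64 ω.2).le_add_mul (x + torusRep ω.1) (y + torusRep ω.1)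
      simpa [shiftedField] using this
    · have hae := ae_frequently_hasStrip_and_swap (κ := 1 / 4 / 100)
        (R := 1 / 4 / 100 + 64 + 64 + 1) (by norm_num) (by norm_num)
      filter_upwards [Measure.quasiMeasurePreserving_snd.ae hae] with ω hω u hu
      have hu' : IsSolutionFamily linearSaddle
        (fun y => weight 64 64 ω.2 (y + torusRep ω.1)) u := hu
      refine not_tendsto_of_frequently (a := -(1 / 2) + 1 / 4) (b := 1 / 2 - 1 / 4) (by norm_num)
        (hu'.frequently_le (by norm_num) (by norm_num) (by norm_num) (by norm_num)
          (abs_torusRep_le ω.1) linearSaddle_eq_of_abs_le hω.1)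
        (hu'.frequently_ge (by norm_num) (by norm_num) (by norm_num) (by norm_num)
          (abs_torusRep_le ω.1) linearSaddle_eq_of_abs_le hω.2)
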